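/- **Theorem (Completeness of $R_{EQ}$).** *Linear algebra (LA).* A dimension is either the constant $1$ or a symbol $s$. Every matrix variable $X$ has a type $M\times N$ with $M,N$ dimensions. LA expressions are built from matrix variables by the seven operators: matrix product $AB$ ($M\times L$ and $L\times N$ give $M\times N$), elementwise product $A*B$ and sum $A+B$ (of two expressions of the same type), row aggregation $sum_{row}A$ (type $M\times 1$), column aggregation $sum_{col}A$ (type $1\times N$), total aggregation $sum\,A$ (type $1\times 1$), and transpose $A^{T}$. Two LA expressions $e_1,e_2$ of the same type are *semantically equivalent* if $e_1(d)=e_2(d)$ for all inputs $d$, that is, for all sizes in $\mathbb N$ of the symbolic dimensions and all real matrices of the resulting sizes for the variables. *Relational algebra (RA).* An attribute is an index variable with a symbolic dimension. RA expressions are built from atoms $X(i,j)$ (a matrix variable bound to attributes), the numbers $dim(i)$ and real constants (relations without attributes; $dim(i)$ depends only on the dimension of $i$) by natural join $A*B$, union $A+B$, and aggregation $\sum_U A$ over a finite set $U$ of attributes. $Attr(A)$ denotes the set of free attributes of $A$. *Translation $R_{LR}$.* Bind the rows of $e$ to an attribute $i$ and its columns to an attribute $j$, the same $i,j$ for all expressions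 of a given type; a side of size $1$ gets no attribute. Then, with fresh bound attributes and with $\sum$ over an absent attribute omitted, $X\mapsto X(i,j)$; $A*B\mapsto A(i,j)*B(i,j)$; $A+B\mapsto A(i,j)+B(i,j)$; $AB\mapsto\sum_k A(i,k)*B(k,j)$; $sum_{row}A\mapsto\sum_k A(i,k)$; $sum_{col}A\mapsto\sum_k A(k,j)$; $sum\,A\mapsto\sum_{k,l}A(k,l)$; $A^{T}\mapsto A(j,i)$. *Rules $R_{EQ}$.* 1. $A*(B+C)=A*B+A*C$ if $Attr(B)=Attr(C)$; 2. $\sum_i(A+B)=\sum_iA+\sum_iB$ if $Attr(A)=Attr(B)$; 3. $A*\sum_iB=\sum_i(A*B)$ if $i\notin Attr(A)$, where a bound attribute may be renamed to a fresh one of the same dimension; 4. $\sum_U\sum_WA=\sum_{U\cup W}A$ for disjoint $U,W$; 5. $\sum_iA=A*dim(i)$ if $i\notin Attr(A)$; 6. associativity and commutativity of $+$; 7. associativity and commutativity of $*$. Write $a\;R_{EQ}^*\;b$ if $a$ can be turned into $b$ by finitely many applications of these identities, in either direction and to arbitrary subexpressions. **Claim.** (a) For all LA expressions $e_1,e_2$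 of the same type, $$\bigl(\forall d.\ e_1(d)=e_2(d)\bigr)\iff R_{LR}(e_1)\;R_{EQ}^*\;R_{LR}(e_2).$$ (b) The same equivalence holds for LA expressions that may also contain differences $A-B$ of expressions of the same type, translated as $A+(-1)*B$, if in addition to the rules $R_{EQ}$ one may compute with real constants: replace $a*b$ and $a+b$, for constants $a,b$, by their values; replace $1*A$ by $A$; and replace $A+0*B$ by $A$ if $Attr(A)=Attr(B)$; each in either direction. -/

import Mathlib

/-- The size of one side of a matrix: the constant `1`, or a symbolic dimension `s : δ`,
which every input database interprets by a natural number. -/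
inductive Dim (δ : Type*) where
  | one : Dim δ
  | sym (s : δ) : Dim δ

/-- The size of a dimension when the symbolic dimensions have the sizes `d`. -/
def Dim.size {δ : Type*} (d : δ → ℕ) : Dim δ → ℕ
  | .one => 1
  | .sym s => d s

/-- Linear-algebra expressions of type `m × n` over matrix variables `x : V`, the variable `x`
having the type `(sig x).1 × (sig x).2`. There are the seven operators of the language, and
(matrix) difference, which the translation to relational algebra treats as a derived operator. -/
inductive LA {V δ : Type*} (sig : V → Dim δ × Dim δ) : Dim δ → Dim δ → Type _ where
  | mat (x : V) : LA sig (sig x).1 (sig x).2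
  | mmult {m l n : Dim δ} (A : LA sig m l) (B : LA sig l n) : LA sig m n
  | elemmult {m n : Dim δ} (A B : LA sig m n) : LA sig m n
  | elemplus {m n : Dim δ} (A B : LA sig m n) : LA sig m n
  | rowagg {m n : Dim δ} (A : LA sig m n) : LA sig m .one
  | colagg {m n : Dim δ} (A : LA sig m n) : LA sig .one n
  | agg {m n : Dim δ} (A : LA sig m n) : LA sig .one .one
  | transpose {m n : Dim δ} (A : LA sig m n) : LA sig n m
  | minus {m n : Dim δ} (A B : LA sig m n) : LA sig m n

namespace LA

variable {V δ : Type*} {sig : V → Dim δ × Dim δ}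

/-- The expression is built from matrix variables by the seven operators only. -/
def MinusFree {m n : Dim δ} : LA sig m n → Prop
  | mat _ => True
  | mmult A B => A.MinusFree ∧ B.MinusFree
  | elemmult A B => A.MinusFree ∧ B.MinusFree
  | elemplus A B => A.MinusFree ∧ B.MinusFree
  | rowagg A => A.MinusFree
  | colagg A => A.MinusFree
  | agg A => A.MinusFree
  | transpose A => A.MinusFree
  | minus _ _ => False

/-- The value of an expression when the symbolic dimensions have the sizes `d` and the matrix
variables have the values `T`. -/
def eval (d : δ → ℕ)
    (T : (x : V) → Matrix (Fin ((sig x).1.size d)) (Fin ((sig x).2.size d)) ℝ)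
    {m n : Dim δ} : LA sig m n → Matrix (Fin (m.size d)) (Fin (n.size d)) ℝ
  | mat x => T x
  | mmult A B => A.eval d T * B.eval d T
  | elemmult A B => Matrix.of fun i j => A.eval d T i j * B.eval d T i j
  | elemplus A B => A.eval d T + B.eval d T
  | rowagg A => Matrix.of fun i _ => ∑ j, A.eval d T i j
  | colagg A => Matrix.of fun _ j => ∑ i, A.eval d T i j
  | agg A => Matrix.of fun _ _ => ∑ i, ∑ j, A.eval d T i j
  | transpose A => (A.eval d T).transpose
  | minus A B => A.eval d T - B.eval d T

/-- Semantic equivalence: equal values on all inputs of all dimensions. -/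
def Equivalent {m n : Dim δ} (e₁ e₂ : LA sig m n) : Prop :=
  ∀ (d : δ → ℕ) (T : (x : V) → Matrix (Fin ((sig x).1.size d)) (Fin ((sig x).2.size d)) ℝ),
    e₁.eval d T = e₂.eval d T

end LA

/-- An attribute (index variable): a name together with its symbolic dimension. -/
structure Attr (δ : Type*) where
  name : ℕ
  dim : δ
deriving DecidableEq

/-- Relational-algebra expressions. The leaves are matrix variables bound to a list of attributes,
the numbers `dim(i)` (which depend on the symbolic dimension of `i` only), and real constants;
a number is a relation without attributes. -/
inductive RA (V δ : Type*) where
  | atom (x : V) (is : List (Attr δ)) : RA V δ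
  | dim (s : δ) : RA V δ
  | lit (c : ℝ) : RA V δ
  | join (A B : RA V δ) : RA V δ
  | union (A B : RA V δ) : RA V δ
  | agg (U : Finset (Attr δ)) (A : RA V δ) : RA V δ

namespace RA

variable {V δ : Type*}

/-- The schema of a relational expression: its free attributes. -/
def attrs [DecidableEq δ] : RA V δ → Finset (Attr δ)
  | atom _ is => is.toFinset
  | dim _ => ∅
  | lit _ => ∅
  | join A B => A.attrs ∪ B.attrs
  | union A B => A.attrs ∪ B.attrs
  | agg U A => A.attrs \ U

/-- Apply a permutation of the attributes to all attributes of an expression, bound or free. -/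
def rename (π : Equiv.Perm (Attr δ)) : RA V δ → RA V δ
  | atom x is => atom x (is.map π)
  | dim s => dim s
  | lit c => lit c
  | join A B => join (A.rename π) (B.rename π)
  | union A B => union (A.rename π) (B.rename π)
  | agg U A => agg (U.map π.toEmbedding) (A.rename π)

/-- Aggregation over a list of attributes; over the empty list nothing is done. -/
def sumOver [DecidableEq δ] (is : List (Attr δ)) (A : RA V δ) : RA V δ :=
  if is = [] then A else agg is.toFinset A

/-- The seven equality rules. Unions are unions of relations with the same schema, whence the
hypotheses on schemas in the first two rules. The rule `rename` is the renaming of a bound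
attribute `i` to a fresh attribute `j` of the same dimension that accompanies the third rule;
interchanging `i` and `j` everywhere in `A` makes it free of variable capture. -/
inductive Rule [DecidableEq δ] : RA V δ → RA V δ → Prop
  | join_union (A B C : RA V δ) (h : B.attrs = C.attrs) :
      Rule (join A (union B C)) (union (join A B) (join A C))
  | agg_union (i : Attr δ) (A B : RA V δ) (h : A.attrs = B.attrs) :
      Rule (agg {i} (union A B)) (union (agg {i} A) (agg {i} B))
  | join_agg (i : Attr δ) (A B : RA V δ) (h : i ∉ A.attrs) :
      Rule (join A (agg {i} B)) (agg {i} (join A B))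
  | rename (i j : Attr δ) (A : RA V δ) (hdim : i.dim = j.dim) (h : j ∉ A.attrs) :
      Rule (agg {i} A) (agg {j} (A.rename (Equiv.swap i j)))
  | agg_agg (U W : Finset (Attr δ)) (A : RA V δ) (h : Disjoint U W) :
      Rule (agg U (agg W A)) (agg (U ∪ W) A)
  | agg_absent (i : Attr δ) (A : RA V δ) (h : i ∉ A.attrs) :
      Rule (agg {i} A) (join A (dim i.dim))
  | union_assoc (A B C : RA V δ) : Rule (union (union A B) C) (union A (union B C))
  | union_comm (A B : RA V δ) : Rule (union A B) (union B A)
  | join_assoc (A B C : RA V δ) : Rule (join (join A B) C) (join A (join B C))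
  | join_comm (A B : RA V δ) : Rule (join A B) (join B A)

/-- Computation with real constants: constants are multiplied and added as real numbers, a
factor `1` is dropped, and a summand with the coefficient `0` is dropped. -/
inductive ConstRule [DecidableEq δ] : RA V δ → RA V δ → Prop
  | lit_join (a b : ℝ) : ConstRule (join (lit a) (lit b)) (lit (a * b))
  | lit_union (a b : ℝ) : ConstRule (union (lit a) (lit b)) (lit (a + b))
  | one_join (A : RA V δ) : ConstRule (join (lit 1) A) A
  | union_zero (A B : RA V δ) (h : A.attrs = B.attrs) :
      ConstRule (union A (join (lit 0) B)) A

/-- `Provable R A B`: the expression `A` can be turned into `B` by using the identities in `R`,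
in both directions and inside arbitrary expressions, finitely many times. -/
inductive Provable (R : RA V δ → RA V δ → Prop) : RA V δ → RA V δ → Prop
  | rule {A B : RA V δ} (h : R A B) : Provable R A B
  | refl (A : RA V δ) : Provable R A A
  | symm {A B : RA V δ} (h : Provable R A B) : Provable R B A
  | trans {A B C : RA V δ} (h : Provable R A B) (h' : Provable R B C) : Provable R A C
  | join {A A' B B' : RA V δ} (h : Provable R A A') (h' : Provable R B B') :
      Provable R (join A B) (join A' B')
  | union {A A' B B' : RA V δ} (h : Provable R A A') (h' : Provable R B B') :
      Provable R (union A B) (union A' B')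
  | agg (U : Finset (Attr δ)) {A A' : RA V δ} (h : Provable R A A') :
      Provable R (agg U A) (agg U A')

/-- Provable equality by the seven rules. -/
def REqStar [DecidableEq δ] : RA V δ → RA V δ → Prop := Provable Rule

/-- Provable equality by the seven rules together with computation with real constants. -/
def REqConstStar [DecidableEq δ] : RA V δ → RA V δ → Prop :=
  Provable fun A B => Rule A B ∨ ConstRule A B

end RA

/-- The attribute with the name `i` that is given to a side of a matrix. A side of size `1` gets no
attribute: a row or column vector is a relation with one attribute, and a `1 × 1` matrix is a
relation without attributes. -/
def Dim.slot {δ : Type*} : Dim δ → ℕ → List (Attr δ)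
  | .one, _ => []
  | .sym s, i => [⟨i, s⟩]

namespace LA

variable {V δ : Type*} {sig : V → Dim δ × Dim δ}

/-- The translation to relational algebra, after all inner conversions between matrices and
relations are eliminated by renaming: rows are bound to the attribute name `i`, columns to the
attribute name `j`, and names from `k` on are fresh. -/
def toRA [DecidableEq δ] {m n : Dim δ} : LA sig m n → (i j k : ℕ) → RA V δ
  | mat x, i, j, _ => .atom x ((sig x).1.slot i ++ (sig x).2.slot j)
  | mmult (l := l) A B, i, j, k =>
      .sumOver (l.slot k) (.join (A.toRA i k (k + 1)) (B.toRA k j (k + 1)))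
  | elemmult A B, i, j, k => .join (A.toRA i j k) (B.toRA i j k)
  | elemplus A B, i, j, k => .union (A.toRA i j k) (B.toRA i j k)
  | rowagg (n := n) A, i, _, k => .sumOver (n.slot k) (A.toRA i k (k + 1))
  | colagg (m := m) A, _, j, k => .sumOver (m.slot k) (A.toRA k j (k + 1))
  | agg (m := m) (n := n) A, _, _, k =>
      .sumOver (m.slot k ++ n.slot (k + 1)) (A.toRA k (k + 1) (k + 2))
  | transpose A, i, j, k => A.toRA j i k
  | minus A B, i, j, k => .union (A.toRA i j k) (.join (.lit (-1)) (B.toRA i j k))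

/-- The relational form of an expression; its rows have the attribute name `0` and its columns have
the attribute name `1`. -/
def RLR [DecidableEq δ] {m n : Dim δ} (e : LA sig m n) : RA V δ := e.toRA 0 1 2

end LA

/-!
Soundness is a routine induction: relational expressions are evaluated at valuations of all
attributes (`RA.eval`), every rule preserves the value (`RA.Provable.eval_eq`), and the value of a
translation is the matrix entry of the linear-algebra expression (`LA.eval_toRA`).

For completeness without differences, the rules turn a translation into a nonempty sum of monomials
`∑_U X₁(..) * ... * Xₗ(..)` with a fixed set of free attributes (`RA.isPoly_toRA`). In these
monomials every attribute occurs in an atom, so the atoms determine the bound attributes.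
Isomorphic monomials are provably equal by renaming (`Mono.WF.toCls_map`). It remains to show that two sums of
monomials with equal values agree up to isomorphism of the summands. As the values agree for all
real matrices, they agree as polynomials in the matrix entries. Let `M` be a monomial with the
largest number of attributes in both sums, and evaluate its attributes injectively. The product of
the entries of `M` has a positive coefficient in the value of the sum that contains `M`, hence in
that of the other sum, so it is the product of the entries of some monomial `N` of the other sum at
some valuation. This valuation takes as many values as `M` has attributes, and `N` has no more
attributes than that; so it is injective and gives an isomorphism of `N` with `M`
(`Mono.WF.toCls_eq_of_entries_eq`, `Mono.exists_toCls_eq`). Both are removed, and induction applies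
(`Mono.sum_toCls_eq`). All coefficients are positive, so no cancellation can occur.

With differences, every expression `e` is provably `p + (-1) * q` with `p` and `q` free of
differences (`LA.cls_toRA_eq_sub`). If `e₁` and `e₂` are equivalent, then so are `p₁ + q₂` and
`p₂ + q₁`; these are provably equal by the first part, and the constants allow the summands `q₁`
and `q₂` to be cancelled (`RA.Cls.sub_eq_sub`).
-/

/-! ### Semantics of relational expressions -/

namespace RA

variable {V δ : Type*}

theorem finite_assignments (d : δ → ℕ) (ρ : Attr δ → ℕ) (U : Finset (Attr δ)) :
    {σ : Attr δ → ℕ | (∀ a ∉ U, σ a = ρ a) ∧ ∀ a ∈ U, σ a < d a.dim}.Finite := by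
  have hfin : (Set.univ.pi fun a : U => Set.Iio (d a.1.dim)).Finite :=
    Set.Finite.pi fun _ => Set.finite_Iio _
  refine Set.Finite.of_injOn (f := fun (σ : Attr δ → ℕ) (a : U) => σ a.1) ?_ ?_ hfin
  · intro σ hσ a _
    exact hσ.2 a.1 a.2
  · intro σ hσ τ hτ h
    funext a
    by_cases ha : a ∈ U
    · exact congrFun h ⟨a, ha⟩
    · rw [hσ.1 a ha, hτ.1 a ha]

/-- The valuations of all attributes that agree with `ρ` outside `U` and take values in the range
given by the sizes `d` on `U`. -/
noncomputable def assignments (d : δ → ℕ) (ρ : Attr δ → ℕ) (U : Finset (Attr δ)) :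
    Finset (Attr δ → ℕ) :=
  (finite_assignments d ρ U).toFinset

theorem mem_assignments {d : δ → ℕ} {ρ σ : Attr δ → ℕ} {U : Finset (Attr δ)} :
    σ ∈ assignments d ρ U ↔ (∀ a ∉ U, σ a = ρ a) ∧ ∀ a ∈ U, σ a < d a.dim := by
  simp [assignments]

theorem assignments_empty (d : δ → ℕ) (ρ : Attr δ → ℕ) : assignments d ρ ∅ = {ρ} := by
  ext σ
  simp [mem_assignments, funext_iff]

theorem sum_assignments_singleton [DecidableEq δ] (d : δ → ℕ) (ρ : Attr δ → ℕ) (i : Attr δ)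
    (g : (Attr δ → ℕ) → ℝ) :
    ∑ σ ∈ assignments d ρ {i}, g σ = ∑ v ∈ Finset.range (d i.dim), g (Function.update ρ i v) := by
  have key : ∀ σ ∈ assignments d ρ {i}, Function.update ρ i (σ i) = σ := by
    intro σ hσ
    rw [mem_assignments] at hσ
    funext a
    by_cases ha : a = i
    · subst ha; simp
    · rw [Function.update_of_ne ha, hσ.1 a (by simpa using ha)]
  refine Finset.sum_nbij' (fun σ => σ i) (fun v => Function.update ρ i v) ?_ ?_ key ?_ ?_
  · intro σ hσ
    rw [mem_assignments] at hσ
    simpa using hσ.2 i (by simp)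
  · intro v hv
    rw [mem_assignments]
    refine ⟨fun a ha => Function.update_of_ne (by simpa using ha) _ _, fun a ha => ?_⟩
    obtain rfl : a = i := by simpa using ha
    simpa using hv
  · intro v _
    simp
  · intro σ hσ
    rw [key σ hσ]

theorem sum_assignments_union [DecidableEq δ] (d : δ → ℕ) (ρ : Attr δ → ℕ)
    {U W : Finset (Attr δ)} (h : Disjoint U W) (g : (Attr δ → ℕ) → ℝ) :
    ∑ σ ∈ assignments d ρ (U ∪ W), g σ =
      ∑ σ ∈ assignments d ρ U, ∑ τ ∈ assignments d σ W, g τ := by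
  rw [Finset.sum_sigma']
  symm
  refine Finset.sum_nbij' (fun p => p.2)
    (fun τ => ⟨fun a => if a ∈ W then ρ a else τ a, τ⟩) ?_ ?_ ?_ ?_ ?_
  · rintro ⟨σ, τ⟩ hp
    simp only [Finset.mem_sigma, mem_assignments, Finset.mem_union, not_or] at hp ⊢
    refine ⟨fun a ha => (hp.2.1 a ha.2).trans (hp.1.1 a ha.1), fun a ha => ?_⟩
    by_cases haW : a ∈ W
    · exact hp.2.2 a haW
    · rw [hp.2.1 a haW]
      exact hp.1.2 a (ha.resolve_right haW)
  · intro τ hτ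
    simp only [Finset.mem_sigma, mem_assignments, Finset.mem_union, not_or] at hτ ⊢
    refine ⟨⟨fun a ha => ?_, fun a ha => ?_⟩, fun a ha => by simp [ha],
      fun a ha => hτ.2 a (.inr ha)⟩
    · by_cases haW : a ∈ W
      · simp [haW]
      · simpa [haW] using hτ.1 a ⟨ha, haW⟩
    · rw [if_neg (Finset.disjoint_left.1 h ha)]
      exact hτ.2 a (.inl ha)
  · rintro ⟨σ, τ⟩ hp
    simp only [Finset.mem_sigma, mem_assignments] at hp
    have : (fun a => if a ∈ W then ρ a else τ a) = σ := by
      funext a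
      by_cases haW : a ∈ W
      · rw [if_pos haW, hp.1.1 a (Finset.disjoint_right.1 h haW)]
      · rw [if_neg haW, hp.2.1 a haW]
    simp [this]
  · intro τ _
    rfl
  · intro p _
    rfl

/-- The value of a relational expression at the valuation `ρ` of the attributes, when the symbolic
dimensions have the sizes `d` and the entry of the variable `x` with the list of indices `l` is
`F x l`. The value is defined for every expression, whether or not its atoms are well-typed. -/
noncomputable def eval (F : V → List ℕ → ℝ) (d : δ → ℕ) : RA V δ → (Attr δ → ℕ) → ℝ
  | atom x is, ρ => F x (is.map ρ)
  | dim s, _ => d s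
  | lit c, _ => c
  | join A B, ρ => A.eval F d ρ * B.eval F d ρ
  | union A B, ρ => A.eval F d ρ + B.eval F d ρ
  | agg U A, ρ => ∑ σ ∈ assignments d ρ U, A.eval F d σ

theorem eval_rename (F : V → List ℕ → ℝ) (d : δ → ℕ) (π : Equiv.Perm (Attr δ))
    (hπ : ∀ a, (π a).dim = a.dim) (A : RA V δ) :
    ∀ ρ : Attr δ → ℕ, (A.rename π).eval F d ρ = A.eval F d (ρ ∘ π) := by
  induction A with
  | atom x is => intro ρ; simp [rename, eval]
  | dim s => intro ρ; rfl
  | lit c => intro ρ; rfl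
  | join A B ihA ihB => intro ρ; simp [rename, eval, ihA, ihB]
  | union A B ihA ihB => intro ρ; simp [rename, eval, ihA, ihB]
  | agg U A ih =>
    intro ρ
    simp only [rename, eval, ih]
    refine Finset.sum_nbij' (fun σ => σ ∘ π) (fun σ => σ ∘ π.symm) ?_ ?_ ?_ ?_ ?_
    · intro σ hσ
      rw [mem_assignments] at hσ ⊢
      refine ⟨fun a ha => hσ.1 (π a) (by simpa using ha), fun a ha => ?_⟩
      have := hσ.2 (π a) (by simpa using ha)
      rwa [hπ] at this
    · intro σ hσ
      rw [mem_assignments] at hσ ⊢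
      refine ⟨fun a ha => ?_, fun a ha => ?_⟩
      · have := hσ.1 (π.symm a) (fun h => ha (by
          rw [Finset.mem_map_equiv]; exact h))
        simpa using this
      · rw [Finset.mem_map_equiv] at ha
        have := hσ.2 _ ha
        rwa [← hπ, π.apply_symm_apply] at this
    · intro σ _; funext a; simp
    · intro σ _; funext a; simp
    · intro σ _; rfl

variable [DecidableEq δ]

theorem eval_congr (F : V → List ℕ → ℝ) (d : δ → ℕ) (A : RA V δ) :
    ∀ {ρ ρ' : Attr δ → ℕ}, (∀ a ∈ A.attrs, ρ a = ρ' a) → A.eval F d ρ = A.eval F d ρ' := by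
  induction A with
  | atom x is =>
    intro ρ ρ' h
    simp only [eval]
    congr 1
    exact List.map_congr_left fun a ha => h a (by simpa [attrs] using ha)
  | dim s => intros; rfl
  | lit c => intros; rfl
  | join A B ihA ihB =>
    intro ρ ρ' h
    simp only [attrs, Finset.mem_union] at h
    simp only [eval]
    rw [ihA fun a ha => h a (.inl ha), ihB fun a ha => h a (.inr ha)]
  | union A B ihA ihB =>
    intro ρ ρ' h
    simp only [attrs, Finset.mem_union] at h
    simp only [eval]
    rw [ihA fun a ha => h a (.inl ha), ihB fun a ha => h a (.inr ha)]
  | agg U A ih =>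
    intro ρ ρ' h
    simp only [attrs, Finset.mem_sdiff] at h
    simp only [eval]
    refine Finset.sum_nbij' (fun σ a => if a ∈ U then σ a else ρ' a)
      (fun σ a => if a ∈ U then σ a else ρ a) ?_ ?_ ?_ ?_ ?_
    · intro σ hσ
      rw [mem_assignments] at hσ ⊢
      exact ⟨fun a ha => by simp [ha], fun a ha => by simpa [ha] using hσ.2 a ha⟩
    · intro σ hσ
      rw [mem_assignments] at hσ ⊢
      exact ⟨fun a ha => by simp [ha], fun a ha => by simpa [ha] using hσ.2 a ha⟩
    · intro σ hσ
      rw [mem_assignments] at hσ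
      funext a
      by_cases ha : a ∈ U
      · simp [ha]
      · simp [ha, hσ.1 a ha]
    · intro σ hσ
      rw [mem_assignments] at hσ
      funext a
      by_cases ha : a ∈ U
      · simp [ha]
      · simp [ha, hσ.1 a ha]
    · intro σ hσ
      rw [mem_assignments] at hσ
      refine ih fun a haA => ?_
      by_cases ha : a ∈ U
      · simp [ha]
      · simp [ha, hσ.1 a ha, h a ⟨haA, ha⟩]

theorem dim_swap {i j : Attr δ} (h : i.dim = j.dim) (a : Attr δ) :
    (Equiv.swap i j a).dim = a.dim := by
  by_cases hi : a = i
  · subst hi; simp [h]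
  by_cases hj : a = j
  · subst hj; simp [h]
  rw [Equiv.swap_apply_of_ne_of_ne hi hj]

theorem eval_eq_of_rule (F : V → List ℕ → ℝ) (d : δ → ℕ) {A B : RA V δ} (h : Rule A B)
    (ρ : Attr δ → ℕ) : A.eval F d ρ = B.eval F d ρ := by
  cases h with
  | join_union A B C h => simp only [eval]; ring
  | agg_union i A B h => simp only [eval, Finset.sum_add_distrib]
  | join_agg i A B h =>
    simp only [eval, sum_assignments_singleton, Finset.mul_sum]
    refine Finset.sum_congr rfl fun v _ => ?_
    congr 1
    refine eval_congr F d A fun a ha => ?_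
    rw [Function.update_of_ne]
    rintro rfl
    exact h ha
  | rename i j A hdim h =>
    simp only [eval, sum_assignments_singleton, hdim]
    refine Finset.sum_congr rfl fun v _ => ?_
    rw [eval_rename F d _ (dim_swap hdim)]
    refine eval_congr F d A fun a ha => ?_
    by_cases hai : a = i
    · subst hai; simp
    · have haj : a ≠ j := fun e => h (e ▸ ha)
      rw [Function.comp_apply, Equiv.swap_apply_of_ne_of_ne hai haj,
        Function.update_of_ne hai, Function.update_of_ne haj]
  | agg_agg U W A h => simp only [eval, sum_assignments_union d ρ h]
  | agg_absent i A h =>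
    simp only [eval, sum_assignments_singleton]
    rw [Finset.sum_congr rfl fun v _ => eval_congr F d A (ρ' := ρ) fun a ha =>
      Function.update_of_ne (by rintro rfl; exact h ha) _ _]
    simp [mul_comm]
  | union_assoc A B C => simp only [eval]; ring
  | union_comm A B => simp only [eval]; ring
  | join_assoc A B C => simp only [eval]; ring
  | join_comm A B => simp only [eval]; ring

theorem eval_eq_of_constRule (F : V → List ℕ → ℝ) (d : δ → ℕ) {A B : RA V δ}
    (h : ConstRule A B) (ρ : Attr δ → ℕ) : A.eval F d ρ = B.eval F d ρ := by
  cases h <;> simp [eval]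

theorem attrs_rename (π : Equiv.Perm (Attr δ)) (A : RA V δ) :
    (A.rename π).attrs = A.attrs.map π.toEmbedding := by
  induction A with
  | atom x is => ext a; simp [rename, attrs, Finset.mem_map_equiv, ← Equiv.eq_symm_apply]
  | dim s => rfl
  | lit c => rfl
  | join A B ihA ihB => simp [rename, attrs, ihA, ihB, Finset.map_union]
  | union A B ihA ihB => simp [rename, attrs, ihA, ihB, Finset.map_union]
  | agg U A ih => ext a; simp [rename, attrs, ih, Finset.mem_map_equiv]

theorem attrs_eq_of_rule {A B : RA V δ} (h : Rule A B) : A.attrs = B.attrs := by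
  cases h with
  | join_union A B C h => simp only [attrs, h]; ext; simp
  | agg_union i A B h => simp [attrs, h]
  | join_agg i A B h =>
    simp only [attrs]
    ext a
    simp only [Finset.mem_union, Finset.mem_sdiff, Finset.mem_singleton]
    refine ⟨?_, by tauto⟩
    rintro (ha | ha)
    · exact ⟨.inl ha, fun e => h (e ▸ ha)⟩
    · exact ⟨.inr ha.1, ha.2⟩
  | rename i j A hdim h =>
    simp only [attrs, attrs_rename]
    ext a
    simp only [Finset.mem_sdiff, Finset.mem_singleton, Finset.mem_map_equiv, Equiv.symm_swap]
    by_cases hai : a = i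
    · subst hai
      simp [h]
    by_cases haj : a = j
    · subst haj
      simp [h]
    rw [Equiv.swap_apply_of_ne_of_ne hai haj]
    simp [hai, haj]
  | agg_agg U W A h => simp only [attrs]; ext; simp; tauto
  | agg_absent i A h => simp [attrs, h]
  | union_assoc A B C => simp [attrs, Finset.union_assoc]
  | union_comm A B => simp [attrs, Finset.union_comm]
  | join_assoc A B C => simp [attrs, Finset.union_assoc]
  | join_comm A B => simp [attrs, Finset.union_comm]

theorem attrs_eq_of_constRule {A B : RA V δ} (h : ConstRule A B) : A.attrs = B.attrs := by
  cases h <;> simp_all [attrs]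

end RA

/-! ### Semantics of the translation -/

/-- The index list of a matrix index along one side: a side of size `1` contributes no index. -/
def Dim.index {δ : Type*} : Dim δ → ℕ → List ℕ
  | .one, _ => []
  | .sym _, v => [v]

/-- The valuation `ρ` changed to `v` at the attribute named `k`, if that side has an attribute. -/
def Dim.assign {δ : Type*} [DecidableEq δ] (ρ : Attr δ → ℕ) (k v : ℕ) : Dim δ → Attr δ → ℕ
  | .one => ρ
  | .sym s => Function.update ρ ⟨k, s⟩ v

namespace Dim

variable {δ : Type*}

theorem mem_slot {D : Dim δ} {k : ℕ} {a : Attr δ} (h : a ∈ D.slot k) : a.name = k := by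
  cases D <;> simp_all [slot]

variable [DecidableEq δ]

theorem disjoint_slot (D E : Dim δ) {i j : ℕ} (h : i ≠ j) :
    Disjoint (D.slot i).toFinset (E.slot j).toFinset := by
  rw [Finset.disjoint_left]
  intro a ha hb
  exact h ((mem_slot (List.mem_toFinset.1 ha)).symm.trans (mem_slot (List.mem_toFinset.1 hb)))

theorem map_slot_assign_self (D : Dim δ) (ρ : Attr δ → ℕ) (k v : ℕ) :
    (D.slot k).map (D.assign ρ k v) = D.index v := by
  cases D <;> simp [slot, assign, index]

theorem map_slot_assign_of_ne (D E : Dim δ) (ρ : Attr δ → ℕ) {i k : ℕ} (h : i ≠ k) (v : ℕ) :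
    (E.slot i).map (D.assign ρ k v) = (E.slot i).map ρ := by
  cases D <;> cases E <;> simp [slot, assign, Function.update, h]

theorem sum_assignments_slot (d : δ → ℕ) (ρ : Attr δ → ℕ) (D : Dim δ) (k : ℕ)
    (g : (Attr δ → ℕ) → ℝ) :
    ∑ σ ∈ RA.assignments d ρ (D.slot k).toFinset, g σ =
      ∑ c : Fin (D.size d), g (D.assign ρ k c) := by
  cases D with
  | one => exact (Fin.sum_univ_one fun _ => g ρ).symm ▸ by simp [slot, RA.assignments_empty]
  | sym s =>
    have : ((sym s).slot k).toFinset = {⟨k, s⟩} := by simp [slot]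
    rw [this, RA.sum_assignments_singleton, Finset.sum_range]
    rfl

end Dim

theorem RA.eval_sumOver {V δ : Type*} [DecidableEq δ] (F : V → List ℕ → ℝ) (d : δ → ℕ)
    (l : List (Attr δ)) (A : RA V δ) (ρ : Attr δ → ℕ) :
    (RA.sumOver l A).eval F d ρ = ∑ σ ∈ RA.assignments d ρ l.toFinset, A.eval F d σ := by
  unfold RA.sumOver
  split_ifs with h
  · subst h; simp [RA.assignments_empty]
  · rfl

namespace LA

variable {V δ : Type*} [DecidableEq δ] {sig : V → Dim δ × Dim δ}

theorem eval_toRA {F : V → List ℕ → ℝ} {d : δ → ℕ}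
    {T : (x : V) → Matrix (Fin ((sig x).1.size d)) (Fin ((sig x).2.size d)) ℝ}
    (hF : ∀ x (a : Fin ((sig x).1.size d)) (b : Fin ((sig x).2.size d)),
      F x ((sig x).1.index a ++ (sig x).2.index b) = T x a b)
    {m n : Dim δ} (e : LA sig m n) :
    ∀ {i j k : ℕ} {ρ : Attr δ → ℕ} {a : Fin (m.size d)} {b : Fin (n.size d)},
      i ≠ j → i < k → j < k → (m.slot i).map ρ = m.index a → (n.slot j).map ρ = n.index b →
      (e.toRA i j k).eval F d ρ = e.eval d T a b := by
  induction e with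
  | mat x =>
    intro i j k ρ a b _ _ _ ha hb
    simp only [toRA, RA.eval, List.map_append, ha, hb, hF, eval]
  | @mmult m l n A B ihA ihB =>
    intro i j k ρ a b hij hi hj ha hb
    simp only [toRA, RA.eval_sumOver, Dim.sum_assignments_slot, RA.eval, eval, Matrix.mul_apply]
    refine Finset.sum_congr rfl fun c _ => ?_
    rw [ihA (a := a) (b := c) hi.ne (by omega) (by omega),
      ihB (a := c) (b := b) hj.ne' (by omega) (by omega)]
    all_goals first
      | exact Dim.map_slot_assign_self _ _ _ _
      | rw [Dim.map_slot_assign_of_ne _ _ _ (by omega)]; assumption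
  | elemmult A B ihA ihB =>
    intro i j k ρ a b hij hi hj ha hb
    simp only [toRA, RA.eval, eval, Matrix.of_apply, ihA hij hi hj ha hb, ihB hij hi hj ha hb]
  | elemplus A B ihA ihB =>
    intro i j k ρ a b hij hi hj ha hb
    simp only [toRA, RA.eval, eval, Matrix.add_apply, ihA hij hi hj ha hb, ihB hij hi hj ha hb]
  | rowagg A ih =>
    intro i j k ρ a b hij hi hj ha hb
    simp only [toRA, RA.eval_sumOver, Dim.sum_assignments_slot, eval, Matrix.of_apply]
    refine Finset.sum_congr rfl fun c _ => ih hi.ne (by omega) (by omega) ?_ ?_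
    · rw [Dim.map_slot_assign_of_ne _ _ _ hi.ne]; exact ha
    · exact Dim.map_slot_assign_self _ _ _ _
  | colagg A ih =>
    intro i j k ρ a b hij hi hj ha hb
    simp only [toRA, RA.eval_sumOver, Dim.sum_assignments_slot, eval, Matrix.of_apply]
    refine Finset.sum_congr rfl fun c _ => ih hj.ne' (by omega) (by omega) ?_ ?_
    · exact Dim.map_slot_assign_self _ _ _ _
    · rw [Dim.map_slot_assign_of_ne _ _ _ hj.ne]; exact hb
  | @agg m n A ih =>
    intro i j k ρ a b hij hi hj ha hb
    simp only [toRA, RA.eval_sumOver, List.toFinset_append, eval, Matrix.of_apply,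
      RA.sum_assignments_union d ρ (Dim.disjoint_slot m n (Nat.succ_ne_self k).symm),
      Dim.sum_assignments_slot]
    refine Finset.sum_congr rfl fun c _ => Finset.sum_congr rfl fun c' _ =>
      ih (by omega) (by omega) (by omega) ?_ ?_
    · rw [Dim.map_slot_assign_of_ne _ _ _ (by omega)]
      exact Dim.map_slot_assign_self _ _ _ _
    · exact Dim.map_slot_assign_self _ _ _ _
  | transpose A ih =>
    intro i j k ρ a b hij hi hj ha hb
    simp only [toRA, eval, Matrix.transpose_apply, ih hij.symm hj hi hb ha]
  | minus A B ihA ihB =>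
    intro i j k ρ a b hij hi hj ha hb
    simp only [toRA, RA.eval, eval, Matrix.sub_apply, ihA hij hi hj ha hb, ihB hij hi hj ha hb]
    ring

theorem attrs_sumOver (l : List (Attr δ)) (A : RA V δ) :
    (RA.sumOver l A).attrs = A.attrs \ l.toFinset := by
  unfold RA.sumOver
  split_ifs with h
  · simp [h]
  · rfl

/-- The translation of an expression has exactly the attributes of its two sides. -/
theorem attrs_toRA {m n : Dim δ} (e : LA sig m n) :
    ∀ {i j k : ℕ}, i ≠ j → i < k → j < k →
      (e.toRA i j k).attrs = (m.slot i).toFinset ∪ (n.slot j).toFinset := by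
  induction e with
  | mat x => intros; simp [toRA, RA.attrs]
  | @mmult m l n A B ihA ihB =>
    intro i j k hij hi hj
    have h1 := Dim.disjoint_slot m l hi.ne
    have h2 := Dim.disjoint_slot l n hj.ne'
    rw [toRA, attrs_sumOver, RA.attrs, ihA hi.ne (by omega) (by omega),
      ihB hj.ne' (by omega) (by omega), Finset.union_sdiff_distrib,
      Finset.union_sdiff_cancel_right h1, Finset.union_sdiff_cancel_left h2]
  | elemmult A B ihA ihB =>
    intro i j k hij hi hj
    simp [toRA, RA.attrs, ihA hij hi hj, ihB hij hi hj]
  | elemplus A B ihA ihB =>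
    intro i j k hij hi hj
    simp [toRA, RA.attrs, ihA hij hi hj, ihB hij hi hj]
  | @rowagg m n A ih =>
    intro i j k hij hi hj
    rw [toRA, attrs_sumOver, ih hi.ne (by omega) (by omega),
      Finset.union_sdiff_cancel_right (Dim.disjoint_slot m n hi.ne)]
    simp [Dim.slot]
  | @colagg m n A ih =>
    intro i j k hij hi hj
    rw [toRA, attrs_sumOver, ih hj.ne' (by omega) (by omega),
      Finset.union_sdiff_cancel_left (Dim.disjoint_slot m n hj.ne')]
    simp [Dim.slot]
  | agg A ih =>
    intro i j k hij hi hj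
    rw [toRA, attrs_sumOver, ih (by omega) (by omega) (by omega)]
    simp [Dim.slot]
  | transpose A ih =>
    intro i j k hij hi hj
    rw [toRA, ih hij.symm hj hi, Finset.union_comm]
  | minus A B ihA ihB =>
    intro i j k hij hi hj
    simp [toRA, RA.attrs, ihA hij hi hj, ihB hij hi hj]

end LA

/-! ### Expressions up to provable equality -/

namespace RA

variable {V δ : Type*} {R : RA V δ → RA V δ → Prop}

variable (R) in
/-- Relational expressions up to provable equality; join and union are written as product and
sum. -/
def Cls : Type _ := Quot (Provable R)

variable (R) in
/-- The class of an expression. -/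
def cls (A : RA V δ) : Cls R := Quot.mk _ A

theorem cls_eq_iff {A B : RA V δ} : cls R A = cls R B ↔ Provable R A B := by
  refine ⟨fun h => ?_, fun h => Quot.sound h⟩
  exact (Quot.eqvGen_exact h).rec (fun _ _ h => h) (fun _ => .refl _) (fun _ _ _ ih => .symm ih)
    (fun _ _ _ _ _ ih ih' => .trans ih ih')

namespace Cls

theorem ind {p : Cls R → Prop} (h : ∀ A, p (cls R A)) (a : Cls R) : p a := Quot.ind h a

instance : Mul (Cls R) :=
  ⟨Quot.map₂ RA.join (fun _ _ _ h => .join (.refl _) h) (fun _ _ _ h => .join h (.refl _))⟩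

instance : Add (Cls R) :=
  ⟨Quot.map₂ RA.union (fun _ _ _ h => .union (.refl _) h) (fun _ _ _ h => .union h (.refl _))⟩

theorem cls_join (A B : RA V δ) : cls R (.join A B) = cls R A * cls R B := rfl

theorem cls_union (A B : RA V δ) : cls R (.union A B) = cls R A + cls R B := rfl

variable [DecidableEq δ]

/-- Aggregation of a class over a set of attributes, which does nothing if the set is empty. As
no rule drops an aggregation over the empty set, the case distinction is needed for monomials
without bound attributes. -/
def agg (U : Finset (Attr δ)) (a : Cls R) : Cls R :=
  if U = ∅ then a else Quot.map (RA.agg U) (fun _ _ h => .agg U h) a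

@[simp] theorem agg_empty (a : Cls R) : agg ∅ a = a := if_pos rfl

theorem agg_cls {U : Finset (Attr δ)} (h : U ≠ ∅) (A : RA V δ) :
    agg U (cls R A) = cls R (.agg U A) := if_neg h

theorem agg_singleton (i : Attr δ) (A : RA V δ) : agg {i} (cls R A) = cls R (.agg {i} A) :=
  agg_cls (Finset.singleton_ne_empty i) A

theorem cls_sumOver (l : List (Attr δ)) (A : RA V δ) :
    cls R (RA.sumOver l A) = agg l.toFinset (cls R A) := by
  unfold RA.sumOver
  split_ifs with h
  · simp [h]
  · rw [agg_cls]
    simpa using h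

end Cls

end RA

namespace RA

variable {V δ : Type*} [DecidableEq δ]

/-- A set of identities that contains the seven rules, preserves schemas, and holds in the
semantics. -/
class EqTheory (R : RA V δ → RA V δ → Prop) : Prop where
  of_rule {A B : RA V δ} : Rule A B → R A B
  attrs_eq {A B : RA V δ} : R A B → A.attrs = B.attrs
  eval_eq {A B : RA V δ} : R A B → ∀ F d ρ, A.eval F d ρ = B.eval F d ρ

instance : EqTheory (Rule (V := V) (δ := δ)) where
  of_rule h := h
  attrs_eq := attrs_eq_of_rule
  eval_eq h F d := eval_eq_of_rule F d h

/-- The seven rules together with computation with real constants. -/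
def RuleOrConst (A B : RA V δ) : Prop := Rule A B ∨ ConstRule A B

instance : EqTheory (RuleOrConst (V := V) (δ := δ)) where
  of_rule h := .inl h
  attrs_eq h := h.elim attrs_eq_of_rule attrs_eq_of_constRule
  eval_eq h F d := h.elim (eval_eq_of_rule F d) (eval_eq_of_constRule F d)

variable {R : RA V δ → RA V δ → Prop} [EqTheory R]

theorem Provable.attrs_eq {A B : RA V δ} (h : Provable R A B) : A.attrs = B.attrs := by
  induction h with
  | rule h => exact EqTheory.attrs_eq h
  | refl => rfl
  | symm _ ih => exact ih.symm
  | trans _ _ ih ih' => exact ih.trans ih'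
  | join _ _ ih ih' => simp [attrs, ih, ih']
  | union _ _ ih ih' => simp [attrs, ih, ih']
  | agg U _ ih => simp [attrs, ih]

theorem Provable.eval_eq {A B : RA V δ} (h : Provable R A B) (F : V → List ℕ → ℝ) (d : δ → ℕ) :
    A.eval F d = B.eval F d := by
  induction h with
  | rule h => exact funext fun ρ => EqTheory.eval_eq h F d ρ
  | refl => rfl
  | symm _ ih => exact ih.symm
  | trans _ _ ih ih' => exact ih.trans ih'
  | join _ _ ih ih' => funext ρ; simp [eval, ih, ih']
  | union _ _ ih ih' => funext ρ; simp [eval, ih, ih']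
  | agg U _ ih => funext ρ; simp [eval, ih]

theorem cls_eq_of_rule {A B : RA V δ} (h : Rule A B) : cls R A = cls R B :=
  Quot.sound (.rule (EqTheory.of_rule h))

namespace Cls

instance : CommSemigroup (Cls R) where
  mul_assoc := by
    refine ind fun A => ind fun B => ind fun C => cls_eq_of_rule (.join_assoc A B C)
  mul_comm := by
    refine ind fun A => ind fun B => cls_eq_of_rule (.join_comm A B)

instance : AddCommSemigroup (Cls R) where
  add_assoc := by
    refine ind fun A => ind fun B => ind fun C => cls_eq_of_rule (.union_assoc A B C)
  add_comm := by
    refine ind fun A => ind fun B => cls_eq_of_rule (.union_comm A B)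

/-- The free attributes of a class. -/
def attrs : Cls R → Finset (Attr δ) := Quot.lift RA.attrs fun _ _ h => h.attrs_eq

/-- The value of a class. -/
noncomputable def eval (F : V → List ℕ → ℝ) (d : δ → ℕ) : Cls R → (Attr δ → ℕ) → ℝ :=
  Quot.lift (RA.eval F d) fun _ _ h => h.eval_eq F d

@[simp] theorem attrs_cls (A : RA V δ) : (cls R A).attrs = A.attrs := rfl

@[simp] theorem eval_cls (F : V → List ℕ → ℝ) (d : δ → ℕ) (A : RA V δ) :
    (cls R A).eval F d = A.eval F d := rfl

@[simp] theorem attrs_mul (a b : Cls R) : (a * b).attrs = a.attrs ∪ b.attrs := by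
  induction a using ind; induction b using ind; rfl

@[simp] theorem attrs_add (a b : Cls R) : (a + b).attrs = a.attrs ∪ b.attrs := by
  induction a using ind; induction b using ind; rfl

@[simp] theorem eval_mul (F : V → List ℕ → ℝ) (d : δ → ℕ) (a b : Cls R) (ρ : Attr δ → ℕ) :
    (a * b).eval F d ρ = a.eval F d ρ * b.eval F d ρ := by
  induction a using ind; induction b using ind; rfl

@[simp] theorem eval_add (F : V → List ℕ → ℝ) (d : δ → ℕ) (a b : Cls R) (ρ : Attr δ → ℕ) :
    (a + b).eval F d ρ = a.eval F d ρ + b.eval F d ρ := by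
  induction a using ind; induction b using ind; rfl

@[simp] theorem attrs_agg (U : Finset (Attr δ)) (a : Cls R) : (agg U a).attrs = a.attrs \ U := by
  induction a using ind with | _ A
  by_cases h : U = ∅
  · simp [h]
  · rw [agg_cls h]; rfl

theorem eval_agg (F : V → List ℕ → ℝ) (d : δ → ℕ) (U : Finset (Attr δ)) (a : Cls R)
    (ρ : Attr δ → ℕ) : (agg U a).eval F d ρ = ∑ σ ∈ assignments d ρ U, a.eval F d σ := by
  induction a using ind with | _ A
  by_cases h : U = ∅
  · simp [h, assignments_empty]
  · rw [agg_cls h]; rfl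

theorem agg_agg {U W : Finset (Attr δ)} (h : Disjoint U W) (a : Cls R) :
    agg U (agg W a) = agg (U ∪ W) a := by
  induction a using ind with | _ A
  by_cases hU : U = ∅
  · simp [hU]
  by_cases hW : W = ∅
  · simp [hW]
  rw [agg_cls hW, agg_cls hU, agg_cls (by simp [hU])]
  exact cls_eq_of_rule (.agg_agg U W A h)

theorem agg_insert {i : Attr δ} {U : Finset (Attr δ)} (h : i ∉ U) (a : Cls R) :
    agg (insert i U) a = agg {i} (agg U a) := by
  rw [agg_agg (by simpa using h)]
  rfl

theorem mul_add' (a : Cls R) {b c : Cls R} (h : b.attrs = c.attrs) :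
    a * (b + c) = a * b + a * c := by
  induction a using ind; induction b using ind; induction c using ind
  exact cls_eq_of_rule (.join_union _ _ _ h)

theorem add_mul' {a b : Cls R} (h : a.attrs = b.attrs) (c : Cls R) :
    (a + b) * c = a * c + b * c := by
  rw [mul_comm, mul_add' c h, mul_comm c, mul_comm c]

theorem agg_add (U : Finset (Attr δ)) {a b : Cls R} (h : a.attrs = b.attrs) :
    agg U (a + b) = agg U a + agg U b := by
  induction U using Finset.induction_on with
  | empty => simp
  | insert i U hi ih =>
    rw [agg_insert hi, agg_insert hi, agg_insert hi, ih]
    have h' : (agg U a).attrs = (agg U b).attrs := by simp [h]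
    generalize agg U a = x at *
    generalize agg U b = y at *
    induction x using ind; induction y using ind
    rw [← cls_union, agg_singleton, agg_singleton, agg_singleton]
    exact cls_eq_of_rule (.agg_union i _ _ h')

theorem mul_agg {U : Finset (Attr δ)} {a : Cls R} (h : Disjoint a.attrs U) (b : Cls R) :
    a * agg U b = agg U (a * b) := by
  induction U using Finset.induction_on with
  | empty => simp
  | insert i U hi ih =>
    rw [Finset.disjoint_insert_right] at h
    rw [agg_insert hi, agg_insert hi, ← ih h.2]
    generalize agg U b = y
    induction a using ind; induction y using ind
    rw [← cls_join, agg_singleton, agg_singleton]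
    exact cls_eq_of_rule (.join_agg i _ _ h.1)

theorem agg_mul {U : Finset (Attr δ)} {b : Cls R} (h : Disjoint b.attrs U) (a : Cls R) :
    agg U a * b = agg U (a * b) := by
  rw [mul_comm, mul_agg h, mul_comm]

end Cls

end RA

/-! ### Monomials -/

/-- Induction on nonempty multisets. -/
@[elab_as_elim]
theorem Multiset.induction_on_ne_zero {α : Type*} {p : Multiset α → Prop} (s : Multiset α)
    (h : s ≠ 0) (singleton : ∀ a, p {a}) (cons : ∀ a s, s ≠ 0 → p s → p (a ::ₘ s)) : p s := by
  induction s using Multiset.induction_on with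
  | empty => exact absurd rfl h
  | cons a s ih =>
    by_cases hs : s = 0
    · subst hs; exact singleton a
    · exact cons a s hs (ih hs)

/-- A monomial: the aggregation over `bound` of the join of a multiset of atoms. -/
structure Mono (V δ : Type*) where
  bound : Finset (Attr δ)
  atoms : Multiset (V × List (Attr δ))

namespace Mono

variable {V δ : Type*} [DecidableEq δ]

/-- All attributes that occur in the atoms of a monomial. -/
def vars (M : Mono V δ) : Finset (Attr δ) :=
  (M.atoms.bind fun a => (a.2 : Multiset (Attr δ))).toFinset

theorem mem_vars {M : Mono V δ} {v : Attr δ} : v ∈ M.vars ↔ ∃ a ∈ M.atoms, v ∈ a.2 := by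
  simp [vars]

/-- Substitution of attributes in a monomial. -/
def map (f : Attr δ → Attr δ) (M : Mono V δ) : Mono V δ where
  bound := M.bound.image f
  atoms := M.atoms.map fun a => (a.1, a.2.map f)

/-- The monomial is a well-typed term with the set `S` of free attributes: it has an atom, every
bound attribute occurs, the other attributes that occur are those in `S`, and the dimensions of the
attributes of an atom are those of the matrix variable (the name `0` of the slots plays no
role). -/
structure WF (sig : V → Dim δ × Dim δ) (S : Finset (Attr δ)) (M : Mono V δ) : Prop where
  ne_zero : M.atoms ≠ 0
  disjoint : Disjoint M.bound S
  vars_eq : M.vars = M.bound ∪ S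
  dims : ∀ a ∈ M.atoms, a.2.map Attr.dim = ((sig a.1).1.slot 0 ++ (sig a.1).2.slot 0).map Attr.dim

theorem map_congr {M : Mono V δ} {f g : Attr δ → Attr δ} (hb : M.bound ⊆ M.vars)
    (h : ∀ v ∈ M.vars, f v = g v) : M.map f = M.map g := by
  unfold map
  congr 1
  · exact Finset.image_congr fun v hv => h v (hb hv)
  · refine Multiset.map_congr rfl fun a ha => ?_
    rw [List.map_congr_left fun v hv => h v (mem_vars.2 ⟨a, ha, hv⟩)]

theorem map_map (M : Mono V δ) (f g : Attr δ → Attr δ) : (M.map f).map g = M.map (g ∘ f) := by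
  simp [map, Finset.image_image, Function.comp_def]

theorem map_id' (M : Mono V δ) : M.map id = M := by
  simp [map]

theorem vars_map (M : Mono V δ) (f : Attr δ → Attr δ) : (M.map f).vars = M.vars.image f := by
  ext v
  simp only [mem_vars, Finset.mem_image, map, Multiset.mem_map]
  constructor
  · rintro ⟨_, ⟨a, ha, rfl⟩, hv⟩
    obtain ⟨w, hw, rfl⟩ := List.mem_map.1 hv
    exact ⟨w, ⟨a, ha, hw⟩, rfl⟩
  · rintro ⟨w, ⟨a, ha, hw⟩, rfl⟩
    exact ⟨_, ⟨a, ha, rfl⟩, List.mem_map_of_mem hw⟩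

variable {sig : V → Dim δ × Dim δ} {S : Finset (Attr δ)} {M : Mono V δ}

theorem WF.bound_subset (h : M.WF sig S) : M.bound ⊆ M.vars := by
  rw [h.vars_eq]; exact Finset.subset_union_left

theorem WF.free_subset (h : M.WF sig S) : S ⊆ M.vars := by
  rw [h.vars_eq]; exact Finset.subset_union_right

theorem WF.map (h : M.WF sig S) {f : Attr δ → Attr δ} (hinj : Set.InjOn f M.vars)
    (hdim : ∀ v ∈ M.vars, (f v).dim = v.dim) (hS : ∀ v ∈ S, f v = v) : (M.map f).WF sig S where
  ne_zero := by simpa [Mono.map] using h.ne_zero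
  disjoint := by
    rw [Finset.disjoint_left]
    intro v hv hvS
    obtain ⟨w, hw, rfl⟩ := Finset.mem_image.1 hv
    have := hinj (h.bound_subset hw) (h.free_subset hvS) (hS _ hvS).symm
    exact Finset.disjoint_left.1 h.disjoint hw (this ▸ hvS)
  vars_eq := by
    rw [vars_map, h.vars_eq, Finset.image_union]
    congr 1
    exact (Finset.image_congr hS).trans Finset.image_id
  dims := by
    intro b hb
    obtain ⟨a, ha, rfl⟩ := Multiset.mem_map.1 hb
    rw [← h.dims a ha, List.map_map]
    exact List.map_congr_left fun v hv => hdim v (mem_vars.2 ⟨a, ha, hv⟩)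

open RA

variable {R : RA V δ → RA V δ → Prop} [EqTheory R]

variable (R) in
/-- The join of a nonempty multiset of atoms; the empty join is given the junk value `1`. -/
noncomputable def joinAtoms (s : Multiset (V × List (Attr δ))) : Cls R :=
  WithOne.recOneCoe (motive := fun _ => Cls R) (cls R (.lit 1)) id
    (s.map fun a => (cls R (.atom a.1 a.2) : WithOne (Cls R))).prod

theorem coe_joinAtoms {s : Multiset (V × List (Attr δ))} (h : s ≠ 0) :
    (joinAtoms R s : WithOne (Cls R)) =
      (s.map fun a => (cls R (.atom a.1 a.2) : WithOne (Cls R))).prod := by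
  have : ∃ b : Cls R, (b : WithOne (Cls R)) =
      (s.map fun a => (cls R (.atom a.1 a.2) : WithOne (Cls R))).prod := by
    induction s using Multiset.induction_on with
    | empty => exact absurd rfl h
    | cons a s ih =>
      by_cases hs : s = 0
      · exact ⟨cls R (.atom a.1 a.2), by simp [hs]⟩
      · obtain ⟨b, hb⟩ := ih hs
        exact ⟨cls R (.atom a.1 a.2) * b, by simp [← hb]⟩
  obtain ⟨b, hb⟩ := this
  rw [joinAtoms, ← hb]
  rfl

theorem joinAtoms_singleton (a : V × List (Attr δ)) :
    joinAtoms R {a} = cls R (.atom a.1 a.2) :=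
  WithOne.coe_injective (by rw [coe_joinAtoms (by simp)]; simp)

theorem joinAtoms_add {s t : Multiset (V × List (Attr δ))} (hs : s ≠ 0) (ht : t ≠ 0) :
    joinAtoms R (s + t) = joinAtoms R s * joinAtoms R t :=
  WithOne.coe_injective (by
    rw [WithOne.coe_mul, coe_joinAtoms hs, coe_joinAtoms ht, coe_joinAtoms (by simp [hs])]
    simp)

theorem joinAtoms_cons (a : V × List (Attr δ)) {s : Multiset (V × List (Attr δ))} (hs : s ≠ 0) :
    joinAtoms R (a ::ₘ s) = cls R (.atom a.1 a.2) * joinAtoms R s := by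
  rw [← Multiset.singleton_add, joinAtoms_add (by simp) hs, joinAtoms_singleton]

theorem attrs_joinAtoms {s : Multiset (V × List (Attr δ))} (hs : s ≠ 0) :
    (joinAtoms R s).attrs = (s.bind fun a => (a.2 : Multiset (Attr δ))).toFinset := by
  refine Multiset.induction_on_ne_zero s hs ?_ ?_
  · intro a
    rw [joinAtoms_singleton]
    ext; simp [RA.attrs]
  · intro a s hs ih
    rw [joinAtoms_cons a hs, Cls.attrs_mul, ih]
    ext; simp [RA.attrs]

theorem eval_joinAtoms (F : V → List ℕ → ℝ) (d : δ → ℕ) (ρ : Attr δ → ℕ)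
    {s : Multiset (V × List (Attr δ))} (hs : s ≠ 0) :
    (joinAtoms R s).eval F d ρ = (s.map fun a => F a.1 (a.2.map ρ)).prod := by
  refine Multiset.induction_on_ne_zero s hs ?_ ?_
  · intro a
    rw [joinAtoms_singleton]
    simp [RA.eval]
  · intro a s hs ih
    rw [joinAtoms_cons a hs, Cls.eval_mul, ih]
    simp [RA.eval]

/-- The join of atoms has a representative whose renamings represent the renamed joins. -/
theorem exists_cls_eq_joinAtoms {s : Multiset (V × List (Attr δ))} (hs : s ≠ 0) :
    ∃ A : RA V δ, cls R A = joinAtoms R s ∧ ∀ π : Equiv.Perm (Attr δ),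
      cls R (A.rename π) = joinAtoms R (s.map fun a => (a.1, a.2.map π)) := by
  refine Multiset.induction_on_ne_zero s hs ?_ ?_
  · intro a
    exact ⟨.atom a.1 a.2, by simp [joinAtoms_singleton], fun π => by
      simp [joinAtoms_singleton, RA.rename]⟩
  · rintro a s hs ⟨A, hA, hA'⟩
    refine ⟨.join (.atom a.1 a.2) A, by rw [joinAtoms_cons a hs, ← hA]; rfl, fun π => ?_⟩
    rw [Multiset.map_cons, joinAtoms_cons _ (by simpa using hs), ← hA']
    rfl

variable (R) in
/-- The class of expressions that a monomial denotes. -/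
noncomputable def toCls (M : Mono V δ) : Cls R := Cls.agg M.bound (joinAtoms R M.atoms)

theorem WF.attrs_toCls (h : M.WF sig S) : (M.toCls R).attrs = S := by
  rw [toCls, Cls.attrs_agg, attrs_joinAtoms h.ne_zero]
  change M.vars \ _ = _
  rw [h.vars_eq, Finset.union_sdiff_cancel_left h.disjoint]

theorem WF.eval_toCls (h : M.WF sig S) (F : V → List ℕ → ℝ) (d : δ → ℕ) (ρ : Attr δ → ℕ) :
    (M.toCls R).eval F d ρ =
      ∑ σ ∈ assignments d ρ M.bound, (M.atoms.map fun a => F a.1 (a.2.map σ)).prod := by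
  rw [toCls, Cls.eval_agg]
  exact Finset.sum_congr rfl fun σ _ => eval_joinAtoms F d σ h.ne_zero

end Mono

/-! ### Renaming the bound attributes of a monomial -/

/-- For every finite set of attributes there is an attribute of a given dimension outside of it. -/
theorem Attr.exists_notMem {δ : Type*} (F : Finset (Attr δ)) (s : δ) :
    ∃ a : Attr δ, a.dim = s ∧ a ∉ F := by
  obtain ⟨n, hn⟩ := Infinite.exists_notMem_finset (F.image Attr.name)
  exact ⟨⟨n, s⟩, rfl, fun h => hn (Finset.mem_image_of_mem _ h)⟩

namespace Mono

open RA

variable {V δ : Type*} [DecidableEq δ] {sig : V → Dim δ × Dim δ} {S : Finset (Attr δ)}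
  {M : Mono V δ} {R : RA V δ → RA V δ → Prop} [EqTheory R]

theorem WF.map_swap (h : M.WF sig S) {i j : Attr δ} (hdim : i.dim = j.dim) (hi : i ∉ S)
    (hj : j ∉ S) : (M.map (Equiv.swap i j)).WF sig S :=
  h.map (Equiv.injective _).injOn (fun _ _ => dim_swap hdim _) fun _ hv =>
    Equiv.swap_apply_of_ne_of_ne (fun e => hi (e ▸ hv)) (fun e => hj (e ▸ hv))

theorem WF.mem_vars_iff (h : M.WF sig S) {v : Attr δ} (hv : v ∉ S) :
    v ∈ M.vars ↔ v ∈ M.bound := by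
  simp [h.vars_eq, hv]

/-- A bound attribute may be renamed to one that does not occur. -/
theorem WF.toCls_map_swap_of_notMem (h : M.WF sig S) {i j : Attr δ} (hdim : i.dim = j.dim)
    (hi : i ∈ M.bound) (hj : j ∉ M.vars) :
    (M.map (Equiv.swap i j)).toCls R = M.toCls R := by
  obtain ⟨A, hA, hA'⟩ := exists_cls_eq_joinAtoms (R := R) h.ne_zero
  have hjU : j ∉ M.bound := fun hjU => hj (h.bound_subset hjU)
  have hjA : j ∉ A.attrs := by
    rw [← Cls.attrs_cls (R := R), hA, attrs_joinAtoms h.ne_zero]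
    exact hj
  have himage : M.bound.image (Equiv.swap i j) = insert j (M.bound.erase i) := by
    conv_lhs => rw [← Finset.insert_erase hi, Finset.image_insert, Equiv.swap_apply_left]
    congr 1
    refine (Finset.image_congr fun v hv => ?_).trans Finset.image_id
    have hv := Finset.mem_erase.1 (Finset.mem_coe.1 hv)
    exact Equiv.swap_apply_of_ne_of_ne hv.1 fun e => hjU (e ▸ hv.2)
  have key : Cls.agg {j} (cls R (A.rename (Equiv.swap i j))) = Cls.agg {i} (cls R A) := by
    rw [Cls.agg_singleton, Cls.agg_singleton]
    exact (cls_eq_of_rule (.rename i j A hdim hjA)).symm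
  have hL : (M.map (Equiv.swap i j)).toCls R =
      Cls.agg (insert j (M.bound.erase i)) (cls R (A.rename (Equiv.swap i j))) := by
    rw [toCls, ← himage, hA']
    rfl
  have hR : M.toCls R = Cls.agg (insert i (M.bound.erase i)) (cls R A) := by
    rw [toCls, Finset.insert_erase hi, hA]
  rw [hL, hR, Finset.insert_eq, Finset.insert_eq, Finset.union_comm, Finset.union_comm {i},
    ← Cls.agg_agg, ← Cls.agg_agg, key]
  · simp
  · simp [hjU]

theorem WF.toCls_map_swap (h : M.WF sig S) {i j : Attr δ} (hdim : i.dim = j.dim) (hi : i ∉ S)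
    (hj : j ∉ S) : (M.map (Equiv.swap i j)).toCls R = M.toCls R := by
  by_cases hij : i = j
  · subst hij
    rw [Equiv.swap_self]
    exact congrArg _ M.map_id'
  by_cases hiU : i ∈ M.bound <;> by_cases hjU : j ∈ M.bound
  -- If both attributes are bound, the interchange takes a third, fresh attribute.
  · obtain ⟨k, hk, hkF⟩ := Attr.exists_notMem M.vars i.dim
    have hkS : k ∉ S := fun hkS => hkF (h.free_subset hkS)
    have hik : i ≠ k := fun e => hkF (e ▸ h.bound_subset hiU)
    have hjk : j ≠ k := fun e => hkF (e ▸ h.bound_subset hjU)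
    have h₁ := h.map_swap hk.symm hi hkS
    have h₂ := h₁.map_swap hdim.symm hj hi
    have e : Equiv.swap i j = Equiv.swap k j * (Equiv.swap j i * Equiv.swap i k) := by
      ext v
      by_cases hvi : v = i
      · subst hvi; simp [Equiv.swap_apply_of_ne_of_ne hjk.symm hik.symm]
      by_cases hvj : v = j
      · subst hvj
        simp [Equiv.swap_apply_of_ne_of_ne (Ne.symm hij) hjk, Equiv.swap_apply_of_ne_of_ne hik hij]
      by_cases hvk : v = k
      · subst hvk
        simp [Equiv.swap_apply_of_ne_of_ne hik.symm hjk.symm]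
      · simp [Equiv.swap_apply_of_ne_of_ne, *]
    have hM : M.map (Equiv.swap i j) =
        ((M.map (Equiv.swap i k)).map (Equiv.swap j i)).map (Equiv.swap k j) := by
      rw [map_map, map_map, e]
      rfl
    have m₁ : ∀ v, v ∈ (M.map (Equiv.swap i k)).bound ↔ Equiv.swap i k v ∈ M.bound := by
      intro v
      simp only [Mono.map, Finset.mem_image]
      exact ⟨by rintro ⟨w, hw, rfl⟩; simpa using hw, fun hv => ⟨_, hv, by simp⟩⟩
    have m₂ : ∀ v, v ∈ ((M.map (Equiv.swap i k)).map (Equiv.swap j i)).bound ↔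
        Equiv.swap i k (Equiv.swap j i v) ∈ M.bound := by
      intro v
      rw [← m₁]
      simp only [Mono.map, Finset.mem_image]
      exact ⟨by rintro ⟨w, hw, rfl⟩; simpa using hw, fun hv => ⟨_, hv, by simp⟩⟩
    have hkU : k ∉ M.bound := fun hkU => hkF (h.bound_subset hkU)
    rw [hM, h₂.toCls_map_swap_of_notMem (hk.trans hdim), h₁.toCls_map_swap_of_notMem hdim.symm,
      h.toCls_map_swap_of_notMem hk.symm hiU hkF]
    · rw [m₁, Equiv.swap_apply_of_ne_of_ne (Ne.symm hij) hjk]; exact hjU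
    · rw [h₁.mem_vars_iff hi, m₁]; simpa using hkU
    · rw [m₂, Equiv.swap_apply_of_ne_of_ne hjk.symm hik.symm]; simpa using hiU
    · rw [h₂.mem_vars_iff hj, m₂]; simpa using hkU
  · exact h.toCls_map_swap_of_notMem hdim hiU (by rwa [h.mem_vars_iff hj])
  · rw [Equiv.swap_comm]
    exact h.toCls_map_swap_of_notMem hdim.symm hjU (by rwa [h.mem_vars_iff hi])
  · rw [map_congr (g := id) h.bound_subset fun v hv => ?_, map_id']
    exact Equiv.swap_apply_of_ne_of_ne
      (by rintro rfl; exact hiU ((h.mem_vars_iff hi).1 hv))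
      (by rintro rfl; exact hjU ((h.mem_vars_iff hj).1 hv))

/-- An isomorphic copy of a monomial is provably equal to it. The proof fixes one attribute after
the other by interchanging it with its image. -/
theorem WF.toCls_map (h : M.WF sig S) {f : Attr δ → Attr δ} (hinj : Set.InjOn f M.vars)
    (hdim : ∀ v ∈ M.vars, (f v).dim = v.dim) (hS : ∀ v ∈ S, f v = v) :
    (M.map f).toCls R = M.toCls R := by
  induction hn : (M.vars.filter fun v => f v ≠ v).card using Nat.strong_induction_on
    generalizing M f with
  | _ n ih =>
    by_cases hex : ∃ v ∈ M.vars, f v ≠ v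
    · obtain ⟨v, hv, hfv⟩ := hex
      have hvS : v ∉ S := fun hvS => hfv (hS v hvS)
      have hfvS : f v ∉ S := fun hfS =>
        hfv (hinj (h.free_subset hfS) hv (hS _ hfS))
      have hd := hdim v hv
      set π := Equiv.swap v (f v) with hπ
      have h' := h.map_swap hd.symm hvS hfvS
      have hvars : (M.map π).vars = M.vars.image π := vars_map _ _
      have hππ : ∀ u, π (π u) = u := fun u => Equiv.swap_apply_self _ _ _
      have hM : M.map f = (M.map π).map (f ∘ π) := by
        rw [map_map]
        congr 1
        funext u
        simp [hππ]
      rw [hM, ih _ ?_ h' ?_ ?_ ?_ rfl, h.toCls_map_swap hd.symm hvS hfvS]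
      -- The attributes that were fixed remain so, and now `f v` is fixed as well.
      · rw [← hn, hvars, Finset.filter_image]
        refine Finset.card_image_le.trans_lt (Finset.card_lt_card ?_)
        rw [Finset.ssubset_iff_of_subset]
        · refine ⟨v, by simp [hv, hfv], ?_⟩
          simp [hπ]
        · intro u hu
          simp only [Finset.mem_filter, Function.comp_apply, hππ] at hu ⊢
          refine ⟨hu.1, fun hfu => hu.2 ?_⟩
          rw [hfu, Equiv.swap_apply_of_ne_of_ne]
          · rintro rfl; exact hfv hfu
          · rintro rfl; exact hfv (hinj hu.1 hv hfu)
      · rw [hvars]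
        intro x hx y hy hxy
        obtain ⟨x, hx', rfl⟩ := Finset.mem_image.1 (Finset.mem_coe.1 hx)
        obtain ⟨y, hy', rfl⟩ := Finset.mem_image.1 (Finset.mem_coe.1 hy)
        simp only [Function.comp_apply, hππ] at hxy
        rw [hinj hx' hy' hxy]
      · rw [hvars]
        intro x hx
        obtain ⟨x, hx', rfl⟩ := Finset.mem_image.1 hx
        rw [Function.comp_apply, hππ, hdim x hx', dim_swap hd.symm]
      · intro x hx
        rw [Function.comp_apply, hπ, Equiv.swap_apply_of_ne_of_ne, hS x hx]
        · rintro rfl; exact hvS hx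
        · rintro rfl; exact hfvS hx
    · push Not at hex
      rw [map_congr (g := id) h.bound_subset hex, map_id']

/-- The bound attributes of a monomial can be renamed away from any finite set. -/
theorem WF.exists_disjoint (h : M.WF sig S) (F : Finset (Attr δ)) :
    ∃ M' : Mono V δ, M'.WF sig S ∧ Disjoint M'.bound F ∧ M'.toCls R = M.toCls R := by
  obtain ⟨K, hK⟩ : ∃ K, ∀ a ∈ F ∪ S, a.name < K :=
    ⟨((F ∪ S).sup Attr.name) + 1, fun a ha => Nat.lt_succ_of_le (Finset.le_sup ha)⟩
  -- Shifting the names by `K` moves them out of `F` and out of `S`.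
  let f : Attr δ → Attr δ := fun v => if v ∈ S then v else ⟨v.name + K, v.dim⟩
  have hf : ∀ v ∈ S, f v = v := fun v hv => if_pos hv
  have hf' : ∀ v ∉ S, f v = ⟨v.name + K, v.dim⟩ := fun v hv => if_neg hv
  have hname : ∀ v ∉ S, f v ∉ F ∪ S := fun v hv hvF => by
    have := hK _ hvF
    rw [hf' v hv] at this
    simp at this
  have hinj : Set.InjOn f M.vars := by
    intro v _ w _ hvw
    by_cases hv : v ∈ S <;> by_cases hw : w ∈ S
    · rwa [hf v hv, hf w hw] at hvw
    · exact absurd (by rw [← hvw, hf v hv]; simp [hv]) (hname w hw)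
    · exact absurd (by rw [hvw, hf w hw]; simp [hw]) (hname v hv)
    · rw [hf' v hv, hf' w hw] at hvw
      cases v; cases w
      simpa using hvw
  have hdim : ∀ v ∈ M.vars, (f v).dim = v.dim := by
    intro v _
    by_cases hv : v ∈ S
    · rw [hf v hv]
    · rw [hf' v hv]
  refine ⟨M.map f, h.map hinj hdim hf, ?_, h.toCls_map hinj hdim hf⟩
  rw [Finset.disjoint_left]
  intro w hw hwF
  obtain ⟨v, hv, rfl⟩ := Finset.mem_image.1 hw
  exact hname v (Finset.disjoint_left.1 h.disjoint hv) (Finset.mem_union_left _ hwF)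

end Mono

/-! ### Normal forms -/

namespace RA

open Mono

variable {V δ : Type*} [DecidableEq δ] {R : RA V δ → RA V δ → Prop} [EqTheory R]

/-- The class is a finite nonempty sum of monomials with the set `S` of free attributes. -/
inductive IsPoly (sig : V → Dim δ × Dim δ) (S : Finset (Attr δ)) : Cls R → Prop
  | mono {M : Mono V δ} (h : M.WF sig S) : IsPoly sig S (M.toCls R)
  | add {a b : Cls R} (ha : IsPoly sig S a) (hb : IsPoly sig S b) : IsPoly sig S (a + b)

variable {sig : V → Dim δ × Dim δ} {S S' : Finset (Attr δ)} {a b : Cls R}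

theorem IsPoly.attrs_eq (h : IsPoly sig S a) : a.attrs = S := by
  induction h with
  | mono h => exact h.attrs_toCls
  | add _ _ iha ihb => simp [iha, ihb]

theorem IsPoly.exists_multiset (h : IsPoly sig S a) :
    ∃ Ms : Multiset (Mono V δ), (∀ M ∈ Ms, M.WF sig S) ∧
      (a : WithZero (Cls R)) = (Ms.map fun M => (M.toCls R : WithZero (Cls R))).sum := by
  induction h with
  | @mono M h => exact ⟨{M}, by simpa using h, by simp⟩
  | add _ _ iha ihb =>
    obtain ⟨Ms, hMs, ha⟩ := iha
    obtain ⟨Ns, hNs, hb⟩ := ihb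
    refine ⟨Ms + Ns, fun M hM => (Multiset.mem_add.1 hM).elim (hMs M) (hNs M), ?_⟩
    rw [WithZero.coe_add, ha, hb, Multiset.map_add, Multiset.sum_add]

theorem IsPoly.agg (h : IsPoly sig S a) {W : Finset (Attr δ)} (hW : W ⊆ S) :
    IsPoly sig (S \ W) (Cls.agg W a) := by
  induction h with
  | @mono M h =>
    have hdisj : Disjoint W M.bound := (h.disjoint.mono_right hW).symm
    have : Cls.agg W (M.toCls R) = (⟨W ∪ M.bound, M.atoms⟩ : Mono V δ).toCls R := by
      rw [toCls, Cls.agg_agg hdisj, toCls]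
    rw [this]
    refine .mono ⟨h.ne_zero, ?_, ?_, h.dims⟩
    · rw [Finset.disjoint_union_left]
      exact ⟨Finset.disjoint_sdiff, h.disjoint.mono_right Finset.sdiff_subset⟩
    · change M.vars = _
      rw [h.vars_eq, Finset.union_comm W, Finset.union_assoc, Finset.union_sdiff_of_subset hW]
  | add ha hb iha ihb =>
    rw [Cls.agg_add _ (ha.attrs_eq.trans hb.attrs_eq.symm)]
    exact .add iha ihb

theorem IsPoly.mul_mono {M N : Mono V δ} (hM : M.WF sig S) (hN : N.WF sig S') :
    IsPoly sig (S ∪ S') (M.toCls R * N.toCls R) := by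
  obtain ⟨M', hM', hd, e⟩ := hM.exists_disjoint (R := R) S'
  obtain ⟨N', hN', hd', e'⟩ := hN.exists_disjoint (R := R) (M'.bound ∪ S)
  rw [← e, ← e']
  rw [Finset.disjoint_union_right] at hd'
  have : M'.toCls R * N'.toCls R =
      (⟨N'.bound ∪ M'.bound, M'.atoms + N'.atoms⟩ : Mono V δ).toCls R := by
    rw [toCls, toCls, toCls, joinAtoms_add hM'.ne_zero hN'.ne_zero, Cls.mul_agg, Cls.agg_mul,
      Cls.agg_agg hd'.1]
    · rw [attrs_joinAtoms hN'.ne_zero]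
      change Disjoint N'.vars _
      rw [hN'.vars_eq, Finset.disjoint_union_left]
      exact ⟨hd'.1, hd.symm⟩
    · rw [Cls.attrs_agg, attrs_joinAtoms hM'.ne_zero]
      change Disjoint (M'.vars \ _) _
      rw [hM'.vars_eq, Finset.union_sdiff_cancel_left hM'.disjoint]
      exact hd'.2.symm
  rw [this]
  refine .mono ⟨by simp [hM'.ne_zero], ?_, ?_, ?_⟩
  · simp only [Finset.disjoint_union_left, Finset.disjoint_union_right]
    exact ⟨⟨hd'.2, hM'.disjoint⟩, hN'.disjoint, hd⟩
  · have : (⟨N'.bound ∪ M'.bound, M'.atoms + N'.atoms⟩ : Mono V δ).vars = M'.vars ∪ N'.vars := by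
      ext v
      simp [mem_vars, or_and_right, exists_or]
    rw [this, hM'.vars_eq, hN'.vars_eq]
    ext v
    simp only [Finset.mem_union]
    tauto
  · intro x hx
    exact (Multiset.mem_add.1 hx).elim (hM'.dims x) (hN'.dims x)

theorem IsPoly.mul (ha : IsPoly sig S a) (hb : IsPoly sig S' b) :
    IsPoly sig (S ∪ S') (a * b) := by
  induction ha with
  | mono hM =>
    induction hb with
    | mono hN => exact .mul_mono hM hN
    | add hb hc ihb ihc =>
      rw [Cls.mul_add' _ (hb.attrs_eq.trans hc.attrs_eq.symm)]
      exact .add ihb ihc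
  | add ha hc iha ihc =>
    rw [Cls.add_mul' (ha.attrs_eq.trans hc.attrs_eq.symm)]
    exact .add iha ihc

theorem isPoly_toRA {m n : Dim δ} (e : LA sig m n) (he : e.MinusFree) :
    ∀ {i j k : ℕ}, i ≠ j → i < k → j < k →
      IsPoly sig ((m.slot i).toFinset ∪ (n.slot j).toFinset) (cls R (e.toRA i j k)) := by
  induction e with
  | mat x =>
    intro i j k hij hi hj
    have : cls R (LA.toRA (sig := sig) (.mat x) i j k) =
        (⟨∅, {(x, (sig x).1.slot i ++ (sig x).2.slot j)}⟩ : Mono V δ).toCls R := by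
      rw [toCls, Cls.agg_empty, joinAtoms_singleton]
      rfl
    rw [this]
    refine .mono ⟨by simp, by simp, ?_, ?_⟩
    · ext v; simp [mem_vars]
    · intro a ha
      obtain rfl : a = _ := Multiset.mem_singleton.1 ha
      cases (sig x).1 <;> cases (sig x).2 <;> simp [Dim.slot]
  | @mmult m l n A B ihA ihB =>
    intro i j k hij hi hj
    have h1 := Dim.disjoint_slot m l hi.ne
    have h2 := Dim.disjoint_slot l n hj.ne'
    have := ((ihA he.1 hi.ne (show i < k + 1 by omega) (show k < k + 1 by omega)).mul
      (ihB he.2 hj.ne' (show k < k + 1 by omega) (show j < k + 1 by omega))).agg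
        (W := (l.slot k).toFinset) (by intro v hv; simp only [Finset.mem_union]; tauto)
    rw [Finset.union_sdiff_distrib, Finset.union_sdiff_cancel_right h1,
      Finset.union_sdiff_cancel_left h2] at this
    rw [LA.toRA, Cls.cls_sumOver, Cls.cls_join]
    exact this
  | elemmult A B ihA ihB =>
    intro i j k hij hi hj
    have := (ihA he.1 hij hi hj).mul (ihB he.2 hij hi hj)
    rwa [Finset.union_self] at this
  | elemplus A B ihA ihB =>
    intro i j k hij hi hj
    exact .add (ihA he.1 hij hi hj) (ihB he.2 hij hi hj)
  | @rowagg m n A ih =>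
    intro i j k hij hi hj
    have := (ih he hi.ne (show i < k + 1 by omega) (show k < k + 1 by omega)).agg
      Finset.subset_union_right
    rw [Finset.union_sdiff_cancel_right (Dim.disjoint_slot m n hi.ne)] at this
    rw [LA.toRA, Cls.cls_sumOver]
    simpa [Dim.slot] using this
  | @colagg m n A ih =>
    intro i j k hij hi hj
    have := (ih he hj.ne' (show k < k + 1 by omega) (show j < k + 1 by omega)).agg
      Finset.subset_union_left
    rw [Finset.union_sdiff_cancel_left (Dim.disjoint_slot m n hj.ne')] at this
    rw [LA.toRA, Cls.cls_sumOver]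
    simpa [Dim.slot] using this
  | @agg m n A ih =>
    intro i j k hij hi hj
    have := (ih he (show k ≠ k + 1 by omega) (show k < k + 2 by omega)
      (show k + 1 < k + 2 by omega)).agg (Finset.Subset.refl _)
    rw [Finset.sdiff_self] at this
    rw [LA.toRA, Cls.cls_sumOver, List.toFinset_append]
    simpa [Dim.slot] using this
  | transpose A ih =>
    intro i j k hij hi hj
    rw [LA.toRA, Finset.union_comm]
    exact ih he hij.symm hj hi
  | minus A B => exact he.elim

end RA

/-! ### Linear independence of monomials -/

namespace Mono

open RA

variable {V δ : Type*}

/-- The multiset of matrix entries that are multiplied in the join of the atoms of a monomial, at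
the valuation `σ` of the attributes. -/
def entries (M : Mono V δ) (σ : Attr δ → ℕ) : Multiset (V × List ℕ) :=
  M.atoms.map fun a => (a.1, a.2.map σ)

open scoped Classical in
/-- The value of a monomial as a polynomial in the matrix entries. -/
noncomputable def poly (M : Mono V δ) (d : δ → ℕ) (ρ : Attr δ → ℕ) :
    MvPolynomial (V × List ℕ) ℝ :=
  ∑ σ ∈ assignments d ρ M.bound, MvPolynomial.monomial (Multiset.toFinsupp (M.entries σ)) 1

open scoped Classical in
theorem coeff_poly (M : Mono V δ) (d : δ → ℕ) (ρ : Attr δ → ℕ) (s : Multiset (V × List ℕ)) :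
    (M.poly d ρ).coeff (Multiset.toFinsupp s) =
      ∑ σ ∈ assignments d ρ M.bound, if M.entries σ = s then 1 else 0 := by
  rw [poly, MvPolynomial.coeff_sum]
  refine Finset.sum_congr rfl fun σ _ => ?_
  rw [MvPolynomial.coeff_monomial]
  simp only [EmbeddingLike.apply_eq_iff_eq]

variable [DecidableEq δ] {sig : V → Dim δ × Dim δ} {S : Finset (Attr δ)} {M : Mono V δ}
  {R : RA V δ → RA V δ → Prop} [EqTheory R]

theorem WF.eval_poly (h : M.WF sig S) (d : δ → ℕ) (ρ : Attr δ → ℕ) (F : V × List ℕ → ℝ) :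
    MvPolynomial.eval F (M.poly d ρ) = (M.toCls R).eval (fun x l => F (x, l)) d ρ := by
  classical
  rw [h.eval_toCls, poly, map_sum]
  refine Finset.sum_congr rfl fun σ _ => ?_
  rw [MvPolynomial.eval_monomial, one_mul, entries]
  generalize M.atoms = s
  induction s using Multiset.induction_on with
  | empty => simp
  | cons a s ih =>
    rw [Multiset.map_cons, Multiset.map_cons, Multiset.prod_cons, ← ih, ← Multiset.singleton_add,
      map_add, Finsupp.prod_add_index' (by simp) (by intros; rw [pow_add])]
    simp [Multiset.toFinsupp_singleton]

/-- If the matrix entries of `N` at some valuation `σ` are those of `M` at a valuation `ρ` that is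
injective on `M`, and `N` has no more attributes than `M`, then `N` is isomorphic to `M`. -/
theorem WF.toCls_eq_of_entries_eq {N : Mono V δ} (hM : M.WF sig S) (hN : N.WF sig S)
    (hcard : N.vars.card ≤ M.vars.card) {ρ σ : Attr δ → ℕ} (hρ : Set.InjOn ρ M.vars)
    (hσ : ∀ a ∉ N.bound, σ a = ρ a) (h : N.entries σ = M.entries ρ) :
    N.toCls R = M.toCls R := by
  classical
  -- The inverse of `ρ` needs an attribute as its value outside the range of `ρ`.
  rcases isEmpty_or_nonempty (Attr δ) with hE | hE
  · obtain rfl : σ = ρ := Subsingleton.elim _ _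
    have hb : N.bound = M.bound := Subsingleton.elim _ _
    have hinj : Function.Injective fun a : V × List (Attr δ) => (a.1, a.2.map σ) :=
      fun a b hab => Prod.ext (Prod.mk.inj hab).1
        (List.map_injective_iff.2 (Function.injective_of_subsingleton σ) (Prod.mk.inj hab).2)
    rw [toCls, toCls, hb, Multiset.map_injective hinj h]
  set g := Function.invFunOn ρ (M.vars : Set (Attr δ)) with hg
  have hgρ : ∀ v ∈ M.vars, g (ρ v) = v := fun v hv => hρ.leftInvOn_invFunOn hv
  -- The entries determine the values of the attributes.
  have himage : ∀ (K : Mono V δ) (τ : Attr δ → ℕ),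
      K.vars.image τ = ((K.entries τ).bind fun a => (a.2 : Multiset ℕ)).toFinset := by
    intro K τ
    ext n
    simp only [Finset.mem_image, mem_vars, entries, Multiset.mem_toFinset, Multiset.mem_bind,
      Multiset.mem_map, Multiset.mem_coe]
    constructor
    · rintro ⟨v, ⟨a, ha, hv⟩, rfl⟩
      exact ⟨_, ⟨a, ha, rfl⟩, List.mem_map_of_mem hv⟩
    · rintro ⟨_, ⟨a, ha, rfl⟩, hn⟩
      obtain ⟨v, hv, rfl⟩ := List.mem_map.1 hn
      exact ⟨v, ⟨a, ha, hv⟩, rfl⟩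
  have him : N.vars.image σ = M.vars.image ρ := by rw [himage, himage, h]
  have hσinj : Set.InjOn σ N.vars := by
    rw [← Finset.card_image_iff]
    refine le_antisymm Finset.card_image_le ?_
    rw [him, Finset.card_image_iff.2 hρ]
    exact hcard
  have hmem : ∀ v ∈ N.vars, ∃ w ∈ M.vars, ρ w = σ v := fun v hv =>
    Finset.mem_image.1 (him ▸ Finset.mem_image_of_mem σ hv)
  set f := g ∘ σ with hf
  have hatoms : (N.map f).atoms = M.atoms := by
    have h' : (N.map f).atoms = (N.entries σ).map fun a => (a.1, a.2.map g) := by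
      simp [Mono.map, entries, hf, Function.comp_def]
    rw [h', h, entries, Multiset.map_map]
    refine (Multiset.map_congr rfl fun a ha => ?_).trans (Multiset.map_id _)
    simp only [Function.comp_apply, List.map_map, id]
    refine Prod.ext rfl ((List.map_congr_left fun v hv => ?_).trans (List.map_id _))
    exact hgρ v (mem_vars.2 ⟨a, ha, hv⟩)
  have hinj : Set.InjOn f N.vars := by
    intro v hv w hw hvw
    obtain ⟨v', hv', e⟩ := hmem v hv
    obtain ⟨w', hw', e'⟩ := hmem w hw
    simp only [hf, Function.comp_apply, ← e, ← e', hgρ v' hv', hgρ w' hw'] at hvw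
    exact hσinj hv hw (by rw [← e, ← e', hvw])
  have hdim : ∀ v ∈ N.vars, (f v).dim = v.dim := by
    intro v hv
    obtain ⟨a, ha, hva⟩ := mem_vars.1 hv
    have ha' : (a.1, a.2.map f) ∈ M.atoms := by
      rw [← hatoms]
      exact Multiset.mem_map_of_mem (fun a => (a.1, a.2.map f)) ha
    have e := (hM.dims _ ha').trans (hN.dims _ ha).symm
    rw [List.map_map] at e
    exact List.map_inj_left.1 e v hva
  have hS : ∀ v ∈ S, f v = v := by
    intro v hv
    rw [hf, Function.comp_apply, hσ v (Finset.disjoint_right.1 hN.disjoint hv)]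
    exact hgρ v (hM.free_subset hv)
  have hmap : N.map f = M := by
    have hWF := hN.map hinj hdim hS
    have hvars : (N.map f).vars = M.vars := by rw [vars, hatoms, vars]
    have hbound : (N.map f).bound = M.bound := by
      rw [← Finset.union_sdiff_cancel_right hWF.disjoint, ← hWF.vars_eq, hvars, hM.vars_eq,
        Finset.union_sdiff_cancel_right hM.disjoint]
    generalize N.map f = K at *
    cases K; cases M; simp_all
  rw [← hN.toCls_map hinj hdim hS, hmap]

/-- If two sums of monomials have equal values, then a monomial of the first sum that has at least
as many attributes as all monomials of the second one is isomorphic to one of these: the product of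
its entries at an injective valuation of its attributes has a positive coefficient in the value of
the first sum, hence in that of the second. -/
theorem exists_toCls_eq {Ms Ns : Multiset (Mono V δ)} (hMs : ∀ M ∈ Ms, M.WF sig S)
    (hNs : ∀ N ∈ Ns, N.WF sig S)
    (heq : ∀ F d ρ, (∀ a ∈ S, ρ a < d a.dim) →
      (Ms.map fun M => (M.toCls R).eval F d ρ).sum = (Ns.map fun N => (N.toCls R).eval F d ρ).sum)
    (hM : M ∈ Ms) (hcard : ∀ N ∈ Ns, N.vars.card ≤ M.vars.card) :
    ∃ N ∈ Ns, N.toCls R = M.toCls R := by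
  classical
  obtain ⟨ρ, hρ⟩ : ∃ ρ : Attr δ → ℕ, Set.InjOn ρ M.vars :=
    Set.countable_iff_exists_injOn.1 M.vars.finite_toSet.countable
  have hMW := hMs M hM
  -- All sizes are taken large enough for `ρ` to be one of the valuations summed over.
  let d : δ → ℕ := fun _ => M.vars.sup ρ + 1
  have hd : ∀ a ∈ M.vars, ρ a < d a.dim := fun a ha => Nat.lt_succ_of_le (Finset.le_sup ha)
  have hpoly : (Ms.map fun M => M.poly d ρ).sum = (Ns.map fun N => N.poly d ρ).sum := by
    refine MvPolynomial.funext fun F => ?_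
    rw [map_multiset_sum, map_multiset_sum, Multiset.map_map, Multiset.map_map]
    refine Eq.trans ?_ ((heq (fun x l => F (x, l)) d ρ fun a ha => hd a (hMW.free_subset ha)).trans
      ?_)
    · exact congrArg _ (Multiset.map_congr rfl fun M hM => (hMs M hM).eval_poly d ρ F)
    · exact congrArg _ (Multiset.map_congr rfl fun N hN => ((hNs N hN).eval_poly d ρ F).symm)
  have hcoeff := congrArg
    (MvPolynomial.coeffAddMonoidHom (Multiset.toFinsupp (M.entries ρ))) hpoly
  rw [map_multiset_sum, map_multiset_sum, Multiset.map_map, Multiset.map_map] at hcoeff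
  have hpos : 0 < (M.poly d ρ).coeff (Multiset.toFinsupp (M.entries ρ)) := by
    rw [coeff_poly]
    refine Finset.sum_pos' (fun σ _ => by positivity) ⟨ρ, ?_, by simp⟩
    exact mem_assignments.2 ⟨fun _ _ => rfl, fun a ha => hd a (hMW.bound_subset ha)⟩
  have hne : (Ns.map ((MvPolynomial.coeffAddMonoidHom (Multiset.toFinsupp (M.entries ρ))) ∘
      fun N => N.poly d ρ)).sum ≠ 0 := by
    rw [← hcoeff]
    refine (hpos.trans_le ?_).ne'
    refine Multiset.single_le_sum ?_ _ (Multiset.mem_map_of_mem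
      ((MvPolynomial.coeffAddMonoidHom (Multiset.toFinsupp (M.entries ρ))) ∘
        fun N => N.poly d ρ) hM)
    intro x hx
    obtain ⟨K, _, rfl⟩ := Multiset.mem_map.1 hx
    simp only [Function.comp_apply, MvPolynomial.coeffAddMonoidHom_apply, coeff_poly]
    positivity
  obtain ⟨N, hN, hN0⟩ : ∃ N ∈ Ns,
      (N.poly d ρ).coeff (Multiset.toFinsupp (M.entries ρ)) ≠ 0 := by
    by_contra! hcon
    refine hne (Multiset.sum_eq_zero fun x hx => ?_)
    obtain ⟨K, hK, rfl⟩ := Multiset.mem_map.1 hx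
    exact hcon K hK
  rw [coeff_poly] at hN0
  obtain ⟨σ, hσ, hσ0⟩ := Finset.exists_ne_zero_of_sum_ne_zero hN0
  have he : N.entries σ = M.entries ρ := by
    by_contra hcon
    exact hσ0 (if_neg hcon)
  exact ⟨N, hN, hMW.toCls_eq_of_entries_eq (hNs N hN) (hcard N hN) hρ
    (mem_assignments.1 hσ).1 he⟩

/-- Sums of monomials with equal values are provably equal. -/
theorem sum_toCls_eq {Ms Ns : Multiset (Mono V δ)} (hMs : ∀ M ∈ Ms, M.WF sig S)
    (hNs : ∀ N ∈ Ns, N.WF sig S)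
    (heq : ∀ F d ρ, (∀ a ∈ S, ρ a < d a.dim) →
      (Ms.map fun M => (M.toCls R).eval F d ρ).sum =
        (Ns.map fun N => (N.toCls R).eval F d ρ).sum) :
    (Ms.map fun M => (M.toCls R : WithZero (Cls R))).sum =
      (Ns.map fun N => (N.toCls R : WithZero (Cls R))).sum := by
  classical
  induction hn : Ms.card using Nat.strong_induction_on generalizing Ms Ns with
  | _ n ih =>
    -- Isomorphic monomials can be removed from both sides.
    have hstep : ∀ M ∈ Ms, ∀ N ∈ Ns, N.toCls R = M.toCls R →
        (Ms.map fun M => (M.toCls R : WithZero (Cls R))).sum =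
          (Ns.map fun N => (N.toCls R : WithZero (Cls R))).sum := by
      intro M hM N hN e
      have hlt : (Ms.erase M).card < n := hn ▸ Multiset.card_erase_lt_of_mem hM
      have := ih _ hlt (Ms := Ms.erase M) (Ns := Ns.erase N)
        (fun K hK => hMs K (Multiset.mem_of_mem_erase hK))
        (fun K hK => hNs K (Multiset.mem_of_mem_erase hK))
        (fun F d ρ hρ => by
          have := heq F d ρ hρ
          rw [← Multiset.cons_erase hM, ← Multiset.cons_erase hN, Multiset.map_cons,
            Multiset.map_cons, Multiset.sum_cons, Multiset.sum_cons, e] at this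
          exact add_left_cancel this) rfl
      rw [← Multiset.cons_erase hM, ← Multiset.cons_erase hN, Multiset.map_cons,
        Multiset.map_cons, Multiset.sum_cons, Multiset.sum_cons, e, this]
    by_cases h0 : Ms + Ns = 0
    · obtain ⟨rfl, rfl⟩ := add_eq_zero.1 h0
      rfl
    · obtain ⟨K, hK, hmax⟩ := (Ms + Ns).toFinset.exists_max_image (fun K => K.vars.card)
        (by simpa [Finset.nonempty_iff_ne_empty] using h0)
      simp only [Multiset.mem_toFinset] at hK hmax
      rcases Multiset.mem_add.1 hK with hK | hK
      · obtain ⟨N, hN, e⟩ := exists_toCls_eq hMs hNs heq hK fun N hN =>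
          hmax N (Multiset.mem_add.2 (.inr hN))
        exact hstep K hK N hN e
      · obtain ⟨N, hN, e⟩ := exists_toCls_eq hNs hMs (fun F d ρ hρ => (heq F d ρ hρ).symm) hK
          fun N hN => hmax N (Multiset.mem_add.2 (.inl hN))
        exact hstep N hN K hK e.symm

end Mono

namespace RA

variable {V δ : Type*} [DecidableEq δ] {R : RA V δ → RA V δ → Prop} [EqTheory R]
  {sig : V → Dim δ × Dim δ} {S : Finset (Attr δ)} {a b : Cls R}

theorem IsPoly.eq_of_eval_eq (ha : IsPoly sig S a) (hb : IsPoly sig S b)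
    (h : ∀ F d ρ, (∀ i ∈ S, ρ i < d i.dim) → a.eval F d ρ = b.eval F d ρ) : a = b := by
  -- Evaluation is additive, also on the formal sums of classes.
  have hsum : ∀ (Ms : Multiset (Mono V δ)) (c : Cls R),
      (c : WithZero (Cls R)) = (Ms.map fun M => (M.toCls R : WithZero (Cls R))).sum →
      ∀ F d ρ, c.eval F d ρ = (Ms.map fun M => (M.toCls R).eval F d ρ).sum := by
    intro Ms
    induction Ms using Multiset.induction_on with
    | empty => intro c hc; simp at hc
    | cons M Ms ih =>
      intro c hc F d ρ
      rw [Multiset.map_cons, Multiset.sum_cons] at hc ⊢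
      rcases hs : (Ms.map fun M => (M.toCls R : WithZero (Cls R))).sum with _ | s
      · have hMs : Ms = 0 := by
          induction Ms using Multiset.induction_on with
          | empty => rfl
          | cons N Ns =>
            rw [Multiset.map_cons, Multiset.sum_cons] at hs
            rcases hs' : (Ns.map fun M => (M.toCls R : WithZero (Cls R))).sum with _ | s <;>
              rw [hs'] at hs <;> cases hs
        subst hMs
        simp only [Multiset.map_zero, Multiset.sum_zero, add_zero] at hc ⊢
        rw [WithZero.coe_injective hc]
      · rw [hs] at hc
        have hc' : c = M.toCls R + s := WithZero.coe_injective hc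
        rw [hc', Cls.eval_add, ih s hs.symm]
  obtain ⟨Ms, hMs, ea⟩ := ha.exists_multiset
  obtain ⟨Ns, hNs, eb⟩ := hb.exists_multiset
  refine WithZero.coe_injective ?_
  rw [ea, eb]
  refine Mono.sum_toCls_eq hMs hNs fun F d ρ hρ => ?_
  rw [← hsum Ms a ea, ← hsum Ns b eb, h F d ρ hρ]

end RA

namespace LA

open RA

variable {V δ : Type*} [DecidableEq δ] {sig : V → Dim δ × Dim δ} {m n : Dim δ}

/-- The values of a translation determine the values of the expression. -/
theorem Equivalent.of_eval_eq {e₁ e₂ : LA sig m n}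
    (h : ∀ F d ρ, e₁.RLR.eval F d ρ = e₂.RLR.eval F d ρ) : Equivalent e₁ e₂ := by
  intro d T
  let ix : (x : V) → Fin ((sig x).1.size d) × Fin ((sig x).2.size d) → List ℕ :=
    fun x p => (sig x).1.index p.1 ++ (sig x).2.index p.2
  have hinj : ∀ (D E : Dim δ), Function.Injective
      (fun p : Fin (D.size d) × Fin (E.size d) => D.index p.1 ++ E.index p.2) := by
    rintro (_ | s) (_ | t) ⟨a, b⟩ ⟨a', b'⟩ hab <;>
      simp only [Dim.index, List.nil_append, List.cons_append, List.cons.injEq, and_true,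
        Fin.val_inj] at hab
    · exact Prod.ext (Subsingleton.elim (α := Fin 1) _ _) (Subsingleton.elim (α := Fin 1) _ _)
    · exact Prod.ext (Subsingleton.elim (α := Fin 1) _ _) hab
    · exact Prod.ext hab (Subsingleton.elim (α := Fin 1) _ _)
    · exact Prod.ext hab.1 hab.2
  let F : V → List ℕ → ℝ := fun x => Function.extend (ix x) (fun p => T x p.1 p.2) 0
  have hF : ∀ x (a : Fin ((sig x).1.size d)) (b : Fin ((sig x).2.size d)),
      F x ((sig x).1.index a ++ (sig x).2.index b) = T x a b := fun x a b =>
    (hinj (sig x).1 (sig x).2).extend_apply (fun p => T x p.1 p.2) 0 (a, b)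
  ext a b
  have h0 : (m.slot 0).map (n.assign (m.assign 0 0 a) 1 b) = m.index a := by
    rw [Dim.map_slot_assign_of_ne _ _ _ zero_ne_one, Dim.map_slot_assign_self]
  have h1 : (n.slot 1).map (n.assign (m.assign 0 0 a) 1 b) = n.index b :=
    Dim.map_slot_assign_self _ _ _ _
  rw [← eval_toRA hF e₁ zero_ne_one (by omega : 0 < 2) (by omega) h0 h1,
    ← eval_toRA hF e₂ zero_ne_one (by omega : 0 < 2) (by omega) h0 h1]
  exact h F d _

/-- Equivalent expressions have translations with equal values at every valuation that respects the
sizes. -/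
theorem Equivalent.eval_eq {e₁ e₂ : LA sig m n} (h : Equivalent e₁ e₂) (F : V → List ℕ → ℝ)
    (d : δ → ℕ) (ρ : Attr δ → ℕ)
    (hρ : ∀ a ∈ (m.slot 0).toFinset ∪ (n.slot 1).toFinset, ρ a < d a.dim) :
    e₁.RLR.eval F d ρ = e₂.RLR.eval F d ρ := by
  have hidx : ∀ (D : Dim δ) (i : ℕ), (∀ a ∈ D.slot i, ρ a < d a.dim) →
      ∃ a : Fin (D.size d), (D.slot i).map ρ = D.index a := by
    rintro (_ | s) i hD
    · exact ⟨(0 : Fin 1), rfl⟩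
    · exact ⟨⟨ρ ⟨i, s⟩, hD ⟨i, s⟩ (by simp [Dim.slot])⟩, rfl⟩
  obtain ⟨a, ha⟩ := hidx m 0 fun a ha => hρ a (by simp [ha])
  obtain ⟨b, hb⟩ := hidx n 1 fun a ha => hρ a (by simp [ha])
  have hF : ∀ x (a : Fin ((sig x).1.size d)) (b : Fin ((sig x).2.size d)),
      F x ((sig x).1.index a ++ (sig x).2.index b) =
        Matrix.of (fun (a : Fin ((sig x).1.size d)) (b : Fin ((sig x).2.size d)) =>
          F x ((sig x).1.index a ++ (sig x).2.index b)) a b := fun _ _ _ => rfl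
  rw [RLR, RLR, eval_toRA hF e₁ zero_ne_one (by omega) (by omega) ha hb,
    eval_toRA hF e₂ zero_ne_one (by omega) (by omega) ha hb, h]

theorem cls_RLR_eq {R : RA V δ → RA V δ → Prop} [EqTheory R] {e₁ e₂ : LA sig m n}
    (h₁ : e₁.MinusFree) (h₂ : e₂.MinusFree) (h : Equivalent e₁ e₂) :
    cls R e₁.RLR = cls R e₂.RLR :=
  (isPoly_toRA e₁ h₁ zero_ne_one (by omega) (by omega)).eq_of_eval_eq
    (isPoly_toRA e₂ h₂ zero_ne_one (by omega) (by omega)) fun F d ρ hρ => h.eval_eq F d ρ hρ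

end LA

/-! ### Differences -/

namespace RA.Cls

variable {V δ : Type*} [DecidableEq δ]

/-- The class of the real constant `c`. -/
def lit (c : ℝ) : Cls (RuleOrConst (V := V) (δ := δ)) := cls _ (.lit c)

variable {a b c p q p' q' : Cls (RuleOrConst (V := V) (δ := δ))}

theorem cls_eq_of_constRule {A B : RA V δ} (h : ConstRule A B) :
    cls RuleOrConst A = cls RuleOrConst B := Quot.sound (.rule (.inr h))

@[simp] theorem attrs_lit (c : ℝ) : (lit c : Cls (RuleOrConst (V := V) (δ := δ))).attrs = ∅ := rfl

theorem lit_mul_lit (x y : ℝ) : (lit x * lit y : Cls (RuleOrConst (V := V) (δ := δ))) =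
    lit (x * y) := cls_eq_of_constRule (.lit_join x y)

theorem lit_add_lit (x y : ℝ) : (lit x + lit y : Cls (RuleOrConst (V := V) (δ := δ))) =
    lit (x + y) := cls_eq_of_constRule (.lit_union x y)

theorem lit_one_mul (a : Cls (RuleOrConst (V := V) (δ := δ))) : lit 1 * a = a := by
  induction a using ind
  exact cls_eq_of_constRule (.one_join _)

theorem add_lit_zero_mul (h : a.attrs = b.attrs) : a + lit 0 * b = a := by
  induction a using ind; induction b using ind
  exact cls_eq_of_constRule (.union_zero _ _ h)

theorem add_neg_self (a : Cls (RuleOrConst (V := V) (δ := δ))) :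
    a + lit (-1) * a = lit 0 * a := by
  calc a + lit (-1) * a = lit 1 * a + lit (-1) * a := by rw [lit_one_mul]
    _ = (lit 1 + lit (-1)) * a := (add_mul' (a := lit 1) (b := lit (-1)) rfl a).symm
    _ = lit 0 * a := by rw [lit_add_lit, add_neg_cancel]

theorem neg_neg_mul (a : Cls (RuleOrConst (V := V) (δ := δ))) :
    lit (-1) * (lit (-1) * a) = a := by
  rw [← mul_assoc, lit_mul_lit, neg_mul_neg, one_mul, lit_one_mul]

theorem add_self_add_neg (a : Cls (RuleOrConst (V := V) (δ := δ))) :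
    a + a + lit (-1) * a = a := by
  rw [add_assoc, add_neg_self, add_lit_zero_mul rfl]

theorem sub_mul_sub (h : p.attrs = q.attrs) (h' : p'.attrs = q'.attrs) :
    (p + lit (-1) * q) * (p' + lit (-1) * q') =
      (p * p' + q * q') + lit (-1) * (p * q' + q * p') := by
  have e₁ : lit (-1) * q * (lit (-1) * q') = q * q' := by
    rw [mul_mul_mul_comm, lit_mul_lit, neg_mul_neg, one_mul, lit_one_mul]
  rw [add_mul' (by simp [h]), mul_add' _ (by simp [h']), mul_add' _ (by simp [h']), e₁,
    mul_add' _ (by simp [h, h']), mul_left_comm p, mul_assoc (lit (-1)) q,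
    add_comm (lit (-1) * (q * p')), add_add_add_comm]

theorem sub_add_sub (h : q.attrs = q'.attrs) :
    (p + lit (-1) * q) + (p' + lit (-1) * q') = (p + p') + lit (-1) * (q + q') := by
  rw [mul_add' _ h]
  ac_rfl

theorem sub_sub_sub (h : q.attrs = p'.attrs) (h' : p'.attrs = q'.attrs) :
    (p + lit (-1) * q) + lit (-1) * (p' + lit (-1) * q') = (p + q') + lit (-1) * (q + p') := by
  rw [mul_add' _ (by simp [h']), neg_neg_mul, mul_add' _ h,
    add_comm (lit (-1) * p'), add_add_add_comm]

theorem agg_sub (U : Finset (Attr δ)) (h : p.attrs = q.attrs) :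
    agg U (p + lit (-1) * q) = agg U p + lit (-1) * agg U q := by
  rw [agg_add _ (by simp [h]), mul_agg (by simp)]

/-- Cross-wise equal sums have provably equal differences. -/
theorem sub_eq_sub (hq : p.attrs = q.attrs) (hp' : p.attrs = p'.attrs) (hq' : p.attrs = q'.attrs)
    (h : p + q' = p' + q) : p + lit (-1) * q = p' + lit (-1) * q' := by
  calc p + lit (-1) * q = p + lit (-1) * q + (q' + lit (-1) * q') := by
        rw [add_neg_self, add_lit_zero_mul]; simp [← hq, ← hq']
    _ = (p + q') + lit (-1) * q + lit (-1) * q' := by ac_rfl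
    _ = p' + lit (-1) * q' + (q + lit (-1) * q) := by rw [h]; ac_rfl
    _ = p' + lit (-1) * q' := by
        rw [add_neg_self, add_lit_zero_mul]; simp [← hq, ← hq', ← hp']

end RA.Cls

namespace LA

open RA

variable {V δ : Type*} {sig : V → Dim δ × Dim δ}

/-- Expressions `p` and `q` without differences such that the given expression equals `p - q`. As
there is no expression `0`, a variable `X` is split into `X + X` and `X`. -/
def parts {m n : Dim δ} : LA sig m n → LA sig m n × LA sig m n
  | mat x => (elemplus (mat x) (mat x), mat x)
  | mmult A B =>
      (elemplus (mmult A.parts.1 B.parts.1) (mmult A.parts.2 B.parts.2),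
        elemplus (mmult A.parts.1 B.parts.2) (mmult A.parts.2 B.parts.1))
  | elemmult A B =>
      (elemplus (elemmult A.parts.1 B.parts.1) (elemmult A.parts.2 B.parts.2),
        elemplus (elemmult A.parts.1 B.parts.2) (elemmult A.parts.2 B.parts.1))
  | elemplus A B => (elemplus A.parts.1 B.parts.1, elemplus A.parts.2 B.parts.2)
  | rowagg A => (rowagg A.parts.1, rowagg A.parts.2)
  | colagg A => (colagg A.parts.1, colagg A.parts.2)
  | agg A => (agg A.parts.1, agg A.parts.2)
  | transpose A => (transpose A.parts.1, transpose A.parts.2)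
  | minus A B => (elemplus A.parts.1 B.parts.2, elemplus A.parts.2 B.parts.1)

theorem minusFree_parts {m n : Dim δ} (e : LA sig m n) :
    e.parts.1.MinusFree ∧ e.parts.2.MinusFree := by
  induction e <;> simp_all [parts, MinusFree]

theorem eval_eq_sub {m n : Dim δ} (e : LA sig m n) (d : δ → ℕ)
    (T : (x : V) → Matrix (Fin ((sig x).1.size d)) (Fin ((sig x).2.size d)) ℝ) :
    e.eval d T = e.parts.1.eval d T - e.parts.2.eval d T := by
  induction e with
  | mat x => simp [parts, eval]
  | mmult A B ihA ihB =>
    simp only [parts, eval, ihA, ihB, Matrix.sub_mul, Matrix.mul_sub]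
    abel
  | elemmult A B ihA ihB =>
    ext
    simp only [parts, eval, ihA, ihB, Matrix.of_apply, Matrix.sub_apply, Matrix.add_apply]
    ring
  | elemplus A B ihA ihB => simp only [parts, eval, ihA, ihB]; abel
  | rowagg A ih => ext; simp [parts, eval, ih]
  | colagg A ih => ext; simp [parts, eval, ih]
  | agg A ih => ext; simp [parts, eval, ih]
  | transpose A ih => simp [parts, eval, ih]
  | minus A B ihA ihB => simp only [parts, eval, ihA, ihB]; abel

variable [DecidableEq δ]

theorem cls_toRA_eq_sub {m n : Dim δ} (e : LA sig m n) :
    ∀ {i j k : ℕ}, i ≠ j → i < k → j < k →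
      cls RuleOrConst (e.toRA i j k) =
        cls RuleOrConst (e.parts.1.toRA i j k) +
          Cls.lit (-1) * cls RuleOrConst (e.parts.2.toRA i j k) := by
  have key : ∀ {m n : Dim δ} (A : LA sig m n) {i j k : ℕ}, i ≠ j → i < k → j < k →
      (cls RuleOrConst (A.parts.1.toRA i j k)).attrs =
        (cls RuleOrConst (A.parts.2.toRA i j k)).attrs := fun A i j k h hi hj => by
    simp only [Cls.attrs_cls, attrs_toRA _ h hi hj]
  induction e with
  | mat x =>
    intro i j k _ _ _
    exact (Cls.add_self_add_neg _).symm
  | mmult A B ihA ihB =>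
    intro i j k hij hi hj
    have hk : k < k + 1 := k.lt_succ_self
    have hA := key A hi.ne (hi.trans hk) hk
    have hB := key B hj.ne' hk (hj.trans hk)
    simp only [toRA, parts, Cls.cls_sumOver, Cls.cls_join, Cls.cls_union,
      ihA hi.ne (hi.trans hk) hk, ihB hj.ne' hk (hj.trans hk)]
    rw [Cls.sub_mul_sub hA hB, Cls.agg_sub _ (by simp only [Cls.attrs_add, Cls.attrs_mul, hA, hB]),
      Cls.agg_add _ (by simp only [Cls.attrs_mul, hA, hB]),
      Cls.agg_add _ (by simp only [Cls.attrs_mul, hA, hB])]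
  | elemmult A B ihA ihB =>
    intro i j k hij hi hj
    simp only [toRA, parts, Cls.cls_join, Cls.cls_union, ihA hij hi hj, ihB hij hi hj]
    exact Cls.sub_mul_sub (key A hij hi hj) (key B hij hi hj)
  | elemplus A B ihA ihB =>
    intro i j k hij hi hj
    simp only [toRA, parts, Cls.cls_union, ihA hij hi hj, ihB hij hi hj]
    exact Cls.sub_add_sub (by simp only [Cls.attrs_cls, attrs_toRA _ hij hi hj])
  | rowagg A ih =>
    intro i j k hij hi hj
    have hk : k < k + 1 := k.lt_succ_self
    simp only [toRA, parts, Cls.cls_sumOver, ih hi.ne (hi.trans hk) hk]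
    exact Cls.agg_sub _ (key A hi.ne (hi.trans hk) hk)
  | colagg A ih =>
    intro i j k hij hi hj
    have hk : k < k + 1 := k.lt_succ_self
    simp only [toRA, parts, Cls.cls_sumOver, ih hj.ne' hk (hj.trans hk)]
    exact Cls.agg_sub _ (key A hj.ne' hk (hj.trans hk))
  | agg A ih =>
    intro i j k hij hi hj
    have h₁ : k < k + 2 := by omega
    have h₂ : k + 1 < k + 2 := by omega
    simp only [toRA, parts, Cls.cls_sumOver, ih (Nat.succ_ne_self k).symm h₁ h₂]
    exact Cls.agg_sub _ (key A (Nat.succ_ne_self k).symm h₁ h₂)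
  | transpose A ih =>
    intro i j k hij hi hj
    exact ih hij.symm hj hi
  | minus A B ihA ihB =>
    intro i j k hij hi hj
    simp only [toRA, parts, Cls.cls_union, Cls.cls_join, ihA hij hi hj, ihB hij hi hj]
    exact Cls.sub_sub_sub (by simp only [Cls.attrs_cls, attrs_toRA _ hij hi hj])
      (key B hij hi hj)

theorem cls_RLR_eq_of_equivalent {m n : Dim δ} {e₁ e₂ : LA sig m n} (h : Equivalent e₁ e₂) :
    cls RuleOrConst e₁.RLR = cls RuleOrConst e₂.RLR := by
  have hsum : Equivalent (elemplus e₁.parts.1 e₂.parts.2) (elemplus e₂.parts.1 e₁.parts.2) := by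
    intro d T
    have := h d T
    rw [eval_eq_sub e₁, eval_eq_sub e₂, sub_eq_sub_iff_add_eq_add] at this
    exact this
  have hcls := cls_RLR_eq (R := RuleOrConst)
    (show (elemplus e₁.parts.1 e₂.parts.2).MinusFree from
      ⟨(minusFree_parts e₁).1, (minusFree_parts e₂).2⟩)
    (show (elemplus e₂.parts.1 e₁.parts.2).MinusFree from
      ⟨(minusFree_parts e₂).1, (minusFree_parts e₁).2⟩) hsum
  have h₀ : 0 < 2 := by omega
  have h₁ : 1 < 2 := by omega
  have hattrs : ∀ e e' : LA sig m n, (cls RuleOrConst (e.toRA 0 1 2)).attrs =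
      (cls RuleOrConst (e'.toRA 0 1 2)).attrs := fun e e' => by
    simp only [Cls.attrs_cls, attrs_toRA _ zero_ne_one h₀ h₁]
  rw [RLR, RLR, cls_toRA_eq_sub e₁ zero_ne_one h₀ h₁, cls_toRA_eq_sub e₂ zero_ne_one h₀ h₁]
  exact Cls.sub_eq_sub (hattrs _ _) (hattrs _ _) (hattrs _ _) hcls

end LA

theorem mainTheorem1 {V δ : Type*} [DecidableEq δ] (sig : V → Dim δ × Dim δ) {m n : Dim δ}
    (e₁ e₂ : LA sig m n) :
    (e₁.MinusFree → e₂.MinusFree →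
      (LA.Equivalent e₁ e₂ ↔ RA.REqStar e₁.RLR e₂.RLR)) ∧
    (LA.Equivalent e₁ e₂ ↔ RA.REqConstStar e₁.RLR e₂.RLR) := by
  refine ⟨fun h₁ h₂ => ⟨fun h => ?_, fun h => ?_⟩, fun h => ?_, fun h => ?_⟩
  · exact RA.cls_eq_iff.1 (LA.cls_RLR_eq (R := RA.Rule) h₁ h₂ h)
  · exact .of_eval_eq fun F d ρ => congrFun (RA.Provable.eval_eq h F d) ρ
  · exact RA.cls_eq_iff.1 (LA.cls_RLR_eq_of_equivalent h)
  · change RA.Provable RA.RuleOrConst _ _ at h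
    exact .of_eval_eq fun F d ρ => congrFun (RA.Provable.eval_eq (R := RA.RuleOrConst) h F d) ρ
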